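/- Let $\mathbb H$ be the quaternions, $\mathbb B=\{q\in\mathbb H:|q|<1\}$, $\mathrm{Sp}(1)=\{u\in\mathbb H:|u|=1\}$, and $\mathrm{Sp}(1,1)=\{A\in M_2(\mathbb H): A^*I_{1,1}A=I_{1,1}\}$ with $I_{1,1}=\mathrm{diag}(1,-1)$, a Lie group that is an embedded submanifold of $M_2(\mathbb H)\cong\mathbb R^{16}$; put $\mathrm{Sp}(1)I_2=\{uI_2:u\in\mathrm{Sp}(1)\}$. The quotient $\mathrm{Sp}(1,1)/\mathrm{Sp}(1)I_2$ (left cosets $A\,\mathrm{Sp}(1)I_2$) carries the quotient topology and the smooth structure for which the projection from $\mathrm{Sp}(1,1)$ is a submersion. For functions $f(q)=\sum_n q^na_n$ and $g(q)=\sum_n q^nb_n$ given by power series converging on $\mathbb B$ (the slice regular functions on $\mathbb B$) let $(f*g)(q)=\sum_n q^n\sum_{k=0}^n a_kb_{n-k}$, $f^c(q)=\sum_n q^n\overline{a_n}$, $f^s=f*f^c$, and, if $f^s$ has no zero in $\mathbb B$, $f^{-*}(q)=f^s(q)^{-1}f^c(q)$. For $A=\begin{pmatrix}a&c\\ b&d\end{pmatrix}\in\mathrm{Sp}(1,1)$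 the regular Möbius transformation of $\mathbb B$ associated to $A$ is $\mathcal F_A(q)=(qc+d)^{-*}*(qa+b)$, and $\mathcal M(\mathbb B)=\{\mathcal F_A:A\in\mathrm{Sp}(1,1)\}$. Theorem. The projection $\mathrm{Sp}(1,1)\to\mathrm{Sp}(1,1)/\mathrm{Sp}(1)I_2$ is a smooth submersion, and $\mathcal M(\mathbb B)$ has a smooth manifold structure for which $A\,\mathrm{Sp}(1)I_2\mapsto\mathcal F_{A^{-1}}$ is a well-defined diffeomorphism from $\mathrm{Sp}(1,1)/\mathrm{Sp}(1)I_2$ onto $\mathcal M(\mathbb B)$. For this structure, the map $$\varphi:\mathbb B\times\mathrm{Sp}(1)\to\mathcal M(\mathbb B),\qquad \varphi(a,u)(q)=(1-q\bar a)^{-*}*(q-a)u,$$ is well defined and a diffeomorphism onto $\mathcal M(\mathbb B)$. In particular $\mathcal M(\mathbb B)$ is diffeomorphic to $\mathbb R^4\times S^3$, where $S^3$ is the unit sphere of $\mathbb R^4$. -/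

import Mathlib

open Set
open scoped Manifold ContDiff Matrix Quaternion Topology

attribute [local instance] Matrix.normedAddCommGroup Matrix.normedSpace
noncomputable section

section Submanifold

variable {E H : Type*} [NormedAddCommGroup E] [NormedSpace ℝ E]
  [NormedAddCommGroup H] [NormedSpace ℝ H]

/-- The smooth charts of an embedded submanifold `S` of `E`: local homeomorphisms from `S` to `H`
whose inverses are smooth as maps into `E` and which locally extend to smooth maps on open subsets
of `E`. -/
def submanifoldAtlas (S : Set E) (H : Type*) [NormedAddCommGroup H] [NormedSpace ℝ H] :
    Set (OpenPartialHomeomorph S H) :=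
  {e | ContDiffOn ℝ ∞ (fun y => (e.symm y : E)) e.target ∧
    ∀ x ∈ e.source, ∃ (U : Set E) (f : E → H), IsOpen U ∧ (x : E) ∈ U ∧ ContDiffOn ℝ ∞ f U ∧
      ∀ y ∈ e.source, (y : E) ∈ U → e y = f y}

/-- A subset of `E` covered by domains of charts in `submanifoldAtlas`, as a manifold. -/
@[reducible]
def submanifoldChartedSpace (S : Set E)
    (h : ∀ x : S, ∃ e ∈ submanifoldAtlas S H, x ∈ e.source) : ChartedSpace H S where
  atlas := submanifoldAtlas S H
  chartAt x := (h x).choose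
  mem_chart_source x := (h x).choose_spec.2
  chart_mem_atlas x := (h x).choose_spec.1

theorem submanifold_isManifold (S : Set E)
    (h : ∀ x : S, ∃ e ∈ submanifoldAtlas S H, x ∈ e.source) :
    letI := submanifoldChartedSpace S h
    IsManifold 𝓘(ℝ, H) ∞ S := by
  let _ := submanifoldChartedSpace S h
  refine isManifold_of_contDiffOn _ _ _ ?_
  intro e e' he he' x hx
  simp only [modelWithCornersSelf_coe_symm, preimage_id_eq, id_eq, modelWithCornersSelf_coe, range_id,
    inter_univ, OpenPartialHomeomorph.trans_source, OpenPartialHomeomorph.symm_source, mem_inter_iff,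
    mem_preimage] at hx
  obtain ⟨U, f, hU, hxU, hf, hef⟩ := he'.2 _ hx.2
  have h1 : ContDiffAt ℝ ∞ (fun y => (e.symm y : E)) x :=
    (he.1 x hx.1).contDiffAt (e.open_target.mem_nhds hx.1)
  have h2 : ContDiffAt ℝ ∞ (fun y => f (e.symm y : E)) x :=
    ContDiffAt.comp x ((hf _ hxU).contDiffAt (hU.mem_nhds hxU)) h1
  refine (h2.congr_of_eventuallyEq ?_).contDiffWithinAt
  have c1 : ∀ᶠ y in 𝓝 x, e.symm y ∈ e'.source :=
    (e.continuousAt_symm hx.1).eventually (e'.open_source.mem_nhds hx.2)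
  have c2 : ∀ᶠ y in 𝓝 x, (e.symm y : E) ∈ U :=
    h1.continuousAt.eventually (hU.mem_nhds hxU)
  filter_upwards [c1, c2] with y hy1 hy2
  exact hef _ hy1 hy2

/-- The inclusion of a submanifold is smooth. -/
theorem submanifold_contMDiff_coe (S : Set E)
    (h : ∀ x : S, ∃ e ∈ submanifoldAtlas S H, x ∈ e.source) :
    letI := submanifoldChartedSpace S h
    ContMDiff 𝓘(ℝ, H) 𝓘(ℝ, E) ∞ ((↑) : S → E) := by
  let _ := submanifoldChartedSpace S h
  have := submanifold_isManifold S h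
  intro x
  have hc := (h x).choose_spec
  have hm : chartAt H x ∈ IsManifold.maximalAtlas 𝓘(ℝ, H) ∞ S := IsManifold.chart_mem_maximalAtlas x
  have hx : x ∈ (chartAt H x).source := mem_chart_source H x
  have h1 : ContMDiffAt 𝓘(ℝ, H) 𝓘(ℝ, E) ∞ (fun y => ((chartAt H x).symm y : E)) (chartAt H x x) :=
    ((hc.1.1 _ ((chartAt H x).map_source hx)).contDiffAt
      ((chartAt H x).open_target.mem_nhds ((chartAt H x).map_source hx))).contMDiffAt
  refine (ContMDiffAt.comp x h1 (contMDiffAt_of_mem_maximalAtlas hm hx)).congr_of_eventuallyEq ?_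
  filter_upwards [(chartAt H x).open_source.mem_nhds hx] with y hy
  simp [(chartAt H x).left_inv hy]

/-- The restriction to a submanifold of a smooth map is smooth. -/
theorem submanifold_contMDiffOn_restrict (S : Set E)
    (h : ∀ x : S, ∃ e ∈ submanifoldAtlas S H, x ∈ e.source)
    {F : Type*} [NormedAddCommGroup F] [NormedSpace ℝ F] {U : Set E} {f : E → F}
    (hf : ContDiffOn ℝ ∞ f U) :
    letI := submanifoldChartedSpace S h
    ContMDiffOn 𝓘(ℝ, H) 𝓘(ℝ, F) ∞ (fun x : S => f x) {x : S | (x : E) ∈ U} := by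
  let _ := submanifoldChartedSpace S h
  exact hf.contMDiffOn.comp (submanifold_contMDiff_coe S h).contMDiffOn fun _ hx => hx

/-- A map into a submanifold is smooth if it is smooth as a map into `E`. -/
theorem submanifold_contMDiffOn_of_coe (S : Set E)
    (h : ∀ x : S, ∃ e ∈ submanifoldAtlas S H, x ∈ e.source)
    {F : Type*} [NormedAddCommGroup F] [NormedSpace ℝ F] {U : Set F} (hU : IsOpen U)
    {σ : F → S} (hσ : ContDiffOn ℝ ∞ (fun x => (σ x : E)) U) :
    letI := submanifoldChartedSpace S h
    ContMDiffOn 𝓘(ℝ, F) 𝓘(ℝ, H) ∞ σ U := by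
  let _ := submanifoldChartedSpace S h
  have := submanifold_isManifold S h
  intro x hx
  refine ContMDiffAt.contMDiffWithinAt ?_
  have h1 : ContDiffAt ℝ ∞ (fun x => (σ x : E)) x := (hσ x hx).contDiffAt (hU.mem_nhds hx)
  have hcont : ContinuousAt σ x :=
    (Topology.IsInducing.subtypeVal.continuousAt_iff).2 h1.continuousAt
  set e := chartAt H (σ x) with he
  have hm : e ∈ IsManifold.maximalAtlas 𝓘(ℝ, H) ∞ S := IsManifold.chart_mem_maximalAtlas _
  have hx' : σ x ∈ e.source := mem_chart_source H _
  obtain ⟨V, f, hV, hxV, hf, hef⟩ := (h (σ x)).choose_spec.1.2 (σ x) hx'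
  have h2 : ContDiffAt ℝ ∞ (fun y => f (σ y : E)) x :=
    ContDiffAt.comp x ((hf _ hxV).contDiffAt (hV.mem_nhds hxV)) h1
  have c1 : ∀ᶠ y in 𝓝 x, σ y ∈ e.source := hcont.eventually (e.open_source.mem_nhds hx')
  have c2 : ∀ᶠ y in 𝓝 x, (σ y : E) ∈ V := h1.continuousAt.eventually (hV.mem_nhds hxV)
  have h3 : ContMDiffAt 𝓘(ℝ, F) 𝓘(ℝ, H) ∞ (fun y => e (σ y)) x := by
    refine h2.contMDiffAt.congr_of_eventuallyEq ?_
    filter_upwards [c1, c2] with y hy1 hy2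
    exact hef _ hy1 hy2
  have h4 := contMDiffAt_symm_of_mem_maximalAtlas hm (e.map_source hx')
  refine (ContMDiffAt.comp x h4 h3).congr_of_eventuallyEq ?_
  filter_upwards [c1] with y hy1
  simp [e.left_inv hy1]

end Submanifold

section Quotient

variable {P X F H : Type*} [NormedAddCommGroup F] [NormedSpace ℝ F]
  [NormedAddCommGroup H] [NormedSpace ℝ H]
  [TopologicalSpace P] [ChartedSpace F P] [TopologicalSpace X]

/-- The smooth charts of the base of a submersion `π : P → X`: local homeomorphisms `e` from `X`
to `H` such that `e ∘ π` is smooth and such that `e⁻¹` lifts locally along `π` to smooth maps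
into `P`. -/
def quotientAtlas (F H : Type*) [NormedAddCommGroup F] [NormedSpace ℝ F]
    [NormedAddCommGroup H] [NormedSpace ℝ H] [ChartedSpace F P] (π : P → X) :
    Set (OpenPartialHomeomorph X H) :=
  {e | ContMDiffOn 𝓘(ℝ, F) 𝓘(ℝ, H) ∞ (e ∘ π) (π ⁻¹' e.source) ∧
    ∀ y ∈ e.target, ∃ (U : Set H) (σ : H → P), IsOpen U ∧ y ∈ U ∧ U ⊆ e.target ∧
      ContMDiffOn 𝓘(ℝ, H) 𝓘(ℝ, F) ∞ σ U ∧ ∀ z ∈ U, π (σ z) = e.symm z}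

/-- A space covered by domains of charts in `quotientAtlas`, as a manifold. -/
@[reducible]
def quotientChartedSpace (π : P → X)
    (h : ∀ x : X, ∃ e ∈ quotientAtlas F H π, x ∈ e.source) : ChartedSpace H X where
  atlas := quotientAtlas F H π
  chartAt x := (h x).choose
  mem_chart_source x := (h x).choose_spec.2
  chart_mem_atlas x := (h x).choose_spec.1

theorem quotient_isManifold (π : P → X) (hπ : Continuous π)
    (h : ∀ x : X, ∃ e ∈ quotientAtlas F H π, x ∈ e.source) :
    letI := quotientChartedSpace π h
    IsManifold 𝓘(ℝ, H) ∞ X := by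
  let _ := quotientChartedSpace π h
  refine isManifold_of_contDiffOn _ _ _ ?_
  intro e e' he he' x hx
  simp only [modelWithCornersSelf_coe_symm, preimage_id_eq, id_eq, modelWithCornersSelf_coe, range_id,
    inter_univ, OpenPartialHomeomorph.trans_source, OpenPartialHomeomorph.symm_source, mem_inter_iff,
    mem_preimage] at hx
  obtain ⟨U, σ, hU, hxU, -, hσ, hσe⟩ := he.2 x hx.1
  have hs : σ x ∈ π ⁻¹' e'.source := by
    rw [mem_preimage, hσe x hxU]; exact hx.2
  have h1 : ContMDiffAt 𝓘(ℝ, H) 𝓘(ℝ, F) ∞ σ x := (hσ x hxU).contMDiffAt (hU.mem_nhds hxU)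
  have h2 : ContMDiffAt 𝓘(ℝ, F) 𝓘(ℝ, H) ∞ (e' ∘ π) (σ x) :=
    (he'.1 _ hs).contMDiffAt ((e'.open_source.preimage hπ).mem_nhds hs)
  have h3 : ContDiffAt ℝ ∞ ((e' ∘ π) ∘ σ) x := contMDiffAt_iff_contDiffAt.1 (h2.comp x h1)
  refine (h3.congr_of_eventuallyEq ?_).contDiffWithinAt
  filter_upwards [hU.mem_nhds hxU] with y hy
  simp [hσe y hy]

end Quotient

/-! ### The group `Sp(1,1)` -/

/-- The matrix `I_{1,1} = diag(1, -1)`. -/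
def signatureMatrix : Matrix (Fin 2) (Fin 2) ℍ[ℝ] := !![1, 0; 0, -1]

/-- `Sp(1,1)`, as a subset of the space of `2 × 2` quaternionic matrices. -/
def SpOneOne : Set (Matrix (Fin 2) (Fin 2) ℍ[ℝ]) :=
  {A | Aᴴ * signatureMatrix * A = signatureMatrix}

theorem signatureMatrix_mul_self : signatureMatrix * signatureMatrix = 1 := by
  ext1 i j
  fin_cases i <;> fin_cases j <;> simp [signatureMatrix, Matrix.mul_apply, Fin.sum_univ_two]

theorem signatureMatrix_conjTranspose : signatureMatrixᴴ = signatureMatrix := by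
  ext1 i j
  fin_cases i <;> fin_cases j <;> simp [signatureMatrix]

theorem SpOneOne.inv_mul {A : Matrix (Fin 2) (Fin 2) ℍ[ℝ]} (hA : A ∈ SpOneOne) :
    (signatureMatrix * Aᴴ * signatureMatrix) * A = 1 := by
  have h : Aᴴ * signatureMatrix * A = signatureMatrix := hA
  calc signatureMatrix * Aᴴ * signatureMatrix * A
      = signatureMatrix * (Aᴴ * signatureMatrix * A) := by simp only [mul_assoc]
    _ = 1 := by rw [h, signatureMatrix_mul_self]

theorem SpOneOne.mul_inv {A : Matrix (Fin 2) (Fin 2) ℍ[ℝ]} (hA : A ∈ SpOneOne) :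
    A * (signatureMatrix * Aᴴ * signatureMatrix) = 1 :=
  mul_eq_one_comm.mp (SpOneOne.inv_mul hA)

theorem SpOneOne.mul_mem {A B : Matrix (Fin 2) (Fin 2) ℍ[ℝ]} (hA : A ∈ SpOneOne)
    (hB : B ∈ SpOneOne) : A * B ∈ SpOneOne := by
  have hA : Aᴴ * signatureMatrix * A = signatureMatrix := hA
  have hB : Bᴴ * signatureMatrix * B = signatureMatrix := hB
  change (A * B)ᴴ * signatureMatrix * (A * B) = signatureMatrix
  calc _ = Bᴴ * (Aᴴ * signatureMatrix * A) * B := by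
        rw [Matrix.conjTranspose_mul]; simp only [mul_assoc]
    _ = _ := by rw [hA, hB]

theorem SpOneOne.one_mem : (1 : Matrix (Fin 2) (Fin 2) ℍ[ℝ]) ∈ SpOneOne := by
  change (1 : Matrix (Fin 2) (Fin 2) ℍ[ℝ])ᴴ * signatureMatrix * 1 = signatureMatrix
  simp

theorem SpOneOne.conj_mul {A : Matrix (Fin 2) (Fin 2) ℍ[ℝ]} (hA : A ∈ SpOneOne) :
    A * signatureMatrix * Aᴴ = signatureMatrix := by
  have h := SpOneOne.mul_inv hA
  calc A * signatureMatrix * Aᴴ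
      = A * (signatureMatrix * Aᴴ * signatureMatrix) * signatureMatrix := by
        simp only [mul_assoc, signatureMatrix_mul_self, mul_one]
    _ = _ := by rw [h, one_mul]

theorem SpOneOne.inv_mem {A : Matrix (Fin 2) (Fin 2) ℍ[ℝ]} (hA : A ∈ SpOneOne) :
    signatureMatrix * Aᴴ * signatureMatrix ∈ SpOneOne := by
  change (signatureMatrix * Aᴴ * signatureMatrix)ᴴ * signatureMatrix *
    (signatureMatrix * Aᴴ * signatureMatrix) = signatureMatrix
  simp only [Matrix.conjTranspose_mul, signatureMatrix_conjTranspose,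
    Matrix.conjTranspose_conjTranspose]
  calc signatureMatrix * (A * signatureMatrix) * signatureMatrix *
        (signatureMatrix * Aᴴ * signatureMatrix)
      = signatureMatrix * (A * signatureMatrix *
          (signatureMatrix * signatureMatrix) * Aᴴ) * signatureMatrix := by
        simp only [mul_assoc]
    _ = signatureMatrix := by
        rw [signatureMatrix_mul_self, mul_one, SpOneOne.conj_mul hA, signatureMatrix_mul_self,
          one_mul]

instance : Group SpOneOne where
  mul A B := ⟨A.1 * B.1, SpOneOne.mul_mem A.2 B.2⟩
  one := ⟨1, SpOneOne.one_mem⟩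
  inv A := ⟨signatureMatrix * A.1ᴴ * signatureMatrix, SpOneOne.inv_mem A.2⟩
  mul_assoc A B C := Subtype.ext (mul_assoc A.1 B.1 C.1)
  one_mul A := Subtype.ext (one_mul A.1)
  mul_one A := Subtype.ext (mul_one A.1)
  inv_mul_cancel A := Subtype.ext (SpOneOne.inv_mul A.2)

theorem SpOneOne.coe_mul (A B : SpOneOne) :
    ((A * B : SpOneOne) : Matrix (Fin 2) (Fin 2) ℍ[ℝ]) = A.1 * B.1 := rfl

theorem SpOneOne.coe_one : ((1 : SpOneOne) : Matrix (Fin 2) (Fin 2) ℍ[ℝ]) = 1 := rfl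

instance : ContinuousMul SpOneOne where
  continuous_mul := by
    refine Continuous.subtype_mk ?_ _
    exact (continuous_subtype_val.comp continuous_fst).mul
      (continuous_subtype_val.comp continuous_snd)

/-- The subgroup `Sp(1) I₂` of `Sp(1,1)`. -/
def spOneScalar : Subgroup SpOneOne where
  carrier := {A | ∃ u : ℍ[ℝ], ‖u‖ = 1 ∧ A.1 = Matrix.diagonal fun _ => u}
  mul_mem' := by
    rintro A B ⟨u, hu, hA⟩ ⟨v, hv, hB⟩
    exact ⟨u * v, by rw [norm_mul, hu, hv, one_mul], by rw [SpOneOne.coe_mul, hA, hB]; simp⟩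
  one_mem' := ⟨1, norm_one, by rw [SpOneOne.coe_one]; simp⟩
  inv_mem' := by
    rintro A ⟨u, hu, hA⟩
    refine ⟨star u, by rw [norm_star, hu], ?_⟩
    change signatureMatrix * A.1ᴴ * signatureMatrix = _
    rw [hA]
    rw [Matrix.diagonal_conjTranspose, mul_assoc]
    ext1 i j
    fin_cases i <;> fin_cases j <;>
      simp [signatureMatrix, Matrix.vecMul, dotProduct, Matrix.diagonal_mul, Fin.sum_univ_two]

/-! ### Charts of `Sp(1,1)` and of `Sp(1,1) / Sp(1) I₂` -/

theorem SpOneOne.rel {A : Matrix (Fin 2) (Fin 2) ℍ[ℝ]} (hA : A ∈ SpOneOne) :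
    Quaternion.normSq (A 1 1) = 1 + Quaternion.normSq (A 0 1) ∧
    Quaternion.normSq (A 0 0) = 1 + Quaternion.normSq (A 0 1) ∧
    star (A 1 1) * A 1 0 = star (A 0 1) * A 0 0 := by
  have h : Aᴴ * signatureMatrix * A = signatureMatrix := hA
  have h' := SpOneOne.conj_mul hA
  have h11 := congr_fun (congr_fun h 1) 1
  have h10 := congr_fun (congr_fun h 1) 0
  have h00 := congr_fun (congr_fun h' 0) 0
  simp [signatureMatrix, Matrix.mul_apply, Fin.sum_univ_two, Quaternion.star_mul_self,
    Quaternion.self_mul_star] at h11 h10 h00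
  refine ⟨?_, ?_, ?_⟩
  · have := congrArg QuaternionAlgebra.re h11
    simp at this
    linarith
  · have := congrArg QuaternionAlgebra.re h00
    simp at this
    linarith
  · rw [add_neg_eq_zero] at h10
    exact h10.symm

theorem SpOneOne.ext' {A B : SpOneOne} (h0 : A.1 0 0 = B.1 0 0) (h1 : A.1 0 1 = B.1 0 1)
    (h2 : A.1 1 1 = B.1 1 1) : A = B := by
  obtain ⟨a1, -, a3⟩ := SpOneOne.rel A.2
  obtain ⟨-, -, b3⟩ := SpOneOne.rel B.2
  have hne : star (A.1 1 1) ≠ 0 := by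
    intro h0
    have : A.1 1 1 = 0 := by simpa using h0
    rw [this] at a1
    have := Quaternion.normSq_nonneg (a := A.1 0 1)
    simp at a1
    linarith
  have h3 : A.1 1 0 = B.1 1 0 := by
    apply mul_left_cancel₀ hne
    rw [a3, h2, b3, h0, h1]
  apply Subtype.ext
  ext1 i j
  fin_cases i <;> fin_cases j <;> assumption

/-- The quantity `√(1 + |c|²)`. -/
def rad (c : ℍ[ℝ]) : ℝ := √(1 + Quaternion.normSq c)

theorem rad_pos (c : ℍ[ℝ]) : 0 < rad c := by
  have := Quaternion.normSq_nonneg (a := c)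
  exact Real.sqrt_pos.2 (by linarith)

theorem rad_sq (c : ℍ[ℝ]) : rad c * rad c = 1 + Quaternion.normSq c := by
  have := Quaternion.normSq_nonneg (a := c)
  exact Real.mul_self_sqrt (by linarith)

/-- Inverse stereographic projection onto the unit quaternions. -/
def invStereo (r s t : ℝ) : ℍ[ℝ] :=
  ⟨(1 + (r ^ 2 + s ^ 2 + t ^ 2))⁻¹ * (1 - (r ^ 2 + s ^ 2 + t ^ 2)),
    (1 + (r ^ 2 + s ^ 2 + t ^ 2))⁻¹ * (2 * r), (1 + (r ^ 2 + s ^ 2 + t ^ 2))⁻¹ * (2 * s),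
    (1 + (r ^ 2 + s ^ 2 + t ^ 2))⁻¹ * (2 * t)⟩

theorem normSq_invStereo (r s t : ℝ) : Quaternion.normSq (invStereo r s t) = 1 := by
  have : 1 + (r ^ 2 + s ^ 2 + t ^ 2) ≠ 0 := by positivity
  rw [Quaternion.normSq_def']
  simp only [invStereo]
  field_simp
  ring

theorem one_add_re_invStereo (r s t : ℝ) :
    1 + (invStereo r s t).re = 2 * (1 + (r ^ 2 + s ^ 2 + t ^ 2))⁻¹ := by
  have : 1 + (r ^ 2 + s ^ 2 + t ^ 2) ≠ 0 := by positivity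
  simp only [invStereo]
  field_simp
  ring

theorem invStereo_stereo (y : ℍ[ℝ]) (hy : Quaternion.normSq y = 1) (h : 1 + y.re ≠ 0) :
    invStereo (y.imI / (1 + y.re)) (y.imJ / (1 + y.re)) (y.imK / (1 + y.re)) = y := by
  rw [Quaternion.normSq_def'] at hy
  have hs : 1 + ((y.imI / (1 + y.re)) ^ 2 + (y.imJ / (1 + y.re)) ^ 2 + (y.imK / (1 + y.re)) ^ 2)
      = 2 / (1 + y.re) := by
    field_simp
    linear_combination hy
  have hs' : (y.imI / (1 + y.re)) ^ 2 + (y.imJ / (1 + y.re)) ^ 2 + (y.imK / (1 + y.re)) ^ 2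
      = 2 / (1 + y.re) - 1 := by linarith
  unfold invStereo
  rw [hs, hs']
  ext <;> simp <;> field_simp
  ring

/-- The element of `Sp(1,1)` with upper right entry `c` and diagonal `√(1+|c|²) (y, w)`. -/
def SpOneOne.build (c y w : ℍ[ℝ]) (hy : Quaternion.normSq y = 1) (hw : Quaternion.normSq w = 1) :
    SpOneOne :=
  ⟨!![rad c • y, c; w * star c * y, rad c • w], by
    change _ * _ * _ = _
    have hy' : star y * y = 1 := by rw [Quaternion.star_mul_self, hy]; rfl
    have hw' : star w * w = 1 := by rw [Quaternion.star_mul_self, hw]; rfl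
    have hc : c * star c = ((Quaternion.normSq c : ℝ) : ℍ[ℝ]) := Quaternion.self_mul_star c
    have hc' : star c * c = ((Quaternion.normSq c : ℝ) : ℍ[ℝ]) := Quaternion.star_mul_self c
    ext1 i j
    fin_cases i <;> fin_cases j
    · simp [signatureMatrix, Matrix.mul_apply, Fin.sum_univ_two, smul_smul, rad_sq, hy']
      have : star y * (c * star w) * (w * star c * y)
          = star y * (c * (star w * w) * star c) * y := by simp only [mul_assoc]
      rw [this, hw', mul_one, hc, mul_assoc, Quaternion.coe_mul_eq_smul, mul_smul_comm, hy',
        add_smul, one_smul]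
      abel
    · simp [signatureMatrix, Matrix.mul_apply, Fin.sum_univ_two]
      have : star y * (c * star w) * w = star y * c * (star w * w) := by simp only [mul_assoc]
      rw [this, hw', mul_one]
      simp
    · simp [signatureMatrix, Matrix.mul_apply, Fin.sum_univ_two]
      have : star w * (w * star c * y) = (star w * w) * (star c * y) := by simp only [mul_assoc]
      rw [this, hw', one_mul]
      simp
    · simp [signatureMatrix, Matrix.mul_apply, Fin.sum_univ_two, smul_smul, rad_sq, hw', hc',
        add_smul]
      rw [← Quaternion.algebraMap_def, Algebra.algebraMap_eq_smul_one]
      abel⟩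

@[fun_prop]
theorem contDiff_quaternion_re : ContDiff ℝ ∞ (fun q : ℍ[ℝ] => q.re) := by
  let L : ℍ[ℝ] →ₗ[ℝ] ℝ := QuaternionAlgebra.reₗ (R := ℝ) (-1) 0 (-1)
  exact L.toContinuousLinearMap.contDiff

@[fun_prop]
theorem contDiff_quaternion_imI : ContDiff ℝ ∞ (fun q : ℍ[ℝ] => q.imI) := by
  let L : ℍ[ℝ] →ₗ[ℝ] ℝ := QuaternionAlgebra.imIₗ (R := ℝ) (-1) 0 (-1)
  exact L.toContinuousLinearMap.contDiff

@[fun_prop]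
theorem contDiff_quaternion_imJ : ContDiff ℝ ∞ (fun q : ℍ[ℝ] => q.imJ) := by
  let L : ℍ[ℝ] →ₗ[ℝ] ℝ := QuaternionAlgebra.imJₗ (R := ℝ) (-1) 0 (-1)
  exact L.toContinuousLinearMap.contDiff

@[fun_prop]
theorem contDiff_quaternion_imK : ContDiff ℝ ∞ (fun q : ℍ[ℝ] => q.imK) := by
  let L : ℍ[ℝ] →ₗ[ℝ] ℝ := QuaternionAlgebra.imKₗ (R := ℝ) (-1) 0 (-1)
  exact L.toContinuousLinearMap.contDiff

theorem contDiff_quaternion_mk {F : Type*} [NormedAddCommGroup F] [NormedSpace ℝ F]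
    {f g h k : F → ℝ} (hf : ContDiff ℝ ∞ f) (hg : ContDiff ℝ ∞ g) (hh : ContDiff ℝ ∞ h)
    (hk : ContDiff ℝ ∞ k) : 
    ContDiff (F := ℍ[ℝ]) ℝ ∞ (fun x => ⟨f x, g x, h x, k x⟩) := by
  have h1 : ContDiff ℝ ∞ (fun x => ![f x, g x, h x, k x]) := by
    rw [contDiff_pi]
    intro i
    fin_cases i <;> assumption
  let L : (Fin 4 → ℝ) →ₗ[ℝ] ℍ[ℝ] :=
    (QuaternionAlgebra.linearEquivTuple (R := ℝ) (-1) 0 (-1)).symm.toLinearMap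
  exact L.toContinuousLinearMap.contDiff.comp h1

@[fun_prop]
theorem contDiff_quaternion_star : ContDiff ℝ ∞ (fun q : ℍ[ℝ] => star q) := by
  have h : (fun q : ℍ[ℝ] => star q) = fun q => ⟨q.re, -q.imI, -q.imJ, -q.imK⟩ := by
    funext q
    ext <;> simp
  rw [h]
  refine contDiff_quaternion_mk ?_ ?_ ?_ ?_ <;> fun_prop

@[fun_prop]
theorem contDiff_rad : ContDiff ℝ ∞ (fun c => rad c) := by
  unfold rad
  refine ContDiff.sqrt ?_ ?_
  · simp only [Quaternion.normSq_def']
    fun_prop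
  · intro c
    have := Quaternion.normSq_nonneg (a := c)
    positivity

theorem contDiff_entry (i j : Fin 2) :
    ContDiff ℝ ∞ (fun A : Matrix (Fin 2) (Fin 2) ℍ[ℝ] => A i j) :=
  (Matrix.entryLinearMap ℝ ℍ[ℝ] i j).toContinuousLinearMap.contDiff

theorem contDiff_matrix {F : Type*} [NormedAddCommGroup F] [NormedSpace ℝ F]
    {f : F → Matrix (Fin 2) (Fin 2) ℍ[ℝ]} (h : ∀ i j, ContDiff ℝ ∞ (fun x => f x i j)) :
    ContDiff ℝ ∞ f :=
  contDiff_pi.2 fun i => contDiff_pi.2 fun j => h i j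

/-- Stereographic coordinates of a quaternion, together with four further real coordinates. -/
def stereoCoord (p : ℍ[ℝ]) : Fin 3 → ℝ :=
  ![p.imI / (1 + p.re), p.imJ / (1 + p.re), p.imK / (1 + p.re)]

/-- The coordinates on `Sp(1,1)` near the identity. -/
def SpOneOne.coord (A : Matrix (Fin 2) (Fin 2) ℍ[ℝ]) : EuclideanSpace ℝ (Fin 10) :=
  let c := A 0 1
  let p := stereoCoord ((rad c)⁻¹ • A 0 0)
  let q := stereoCoord ((rad c)⁻¹ • A 1 1)
  !₂[c.re, c.imI, c.imJ, c.imK, p 0, p 1, p 2, q 0, q 1, q 2]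

/-- The inverse of `SpOneOne.coord`. -/
def SpOneOne.param (x : EuclideanSpace ℝ (Fin 10)) : SpOneOne :=
  SpOneOne.build ⟨x 0, x 1, x 2, x 3⟩ (invStereo (x 4) (x 5) (x 6)) (invStereo (x 7) (x 8) (x 9))
    (normSq_invStereo _ _ _) (normSq_invStereo _ _ _)

/-- The coordinates on `Sp(1,1) / Sp(1) I₂` near the class of the identity. -/
def SpOneOne.qcoord (A : Matrix (Fin 2) (Fin 2) ℍ[ℝ]) : EuclideanSpace ℝ (Fin 7) :=
  let r := (rad (A 0 1))⁻¹
  let c := r • (A 0 1 * star (A 1 1))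
  let p := stereoCoord ((r * r) • (A 0 0 * star (A 1 1)))
  !₂[c.re, c.imI, c.imJ, c.imK, p 0, p 1, p 2]

/-- The local section of `Sp(1,1) → Sp(1,1) / Sp(1) I₂` that is inverse to `SpOneOne.qcoord`. -/
def SpOneOne.qparam (x : EuclideanSpace ℝ (Fin 7)) : SpOneOne :=
  SpOneOne.build ⟨x 0, x 1, x 2, x 3⟩ (invStereo (x 4) (x 5) (x 6)) 1
    (normSq_invStereo _ _ _) (by simp)

theorem contDiff_coord_apply {n : ℕ} (i : Fin n) :
    ContDiff ℝ ∞ (fun x : EuclideanSpace ℝ (Fin n) => x i) := by fun_prop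

theorem contDiff_invStereo {F : Type*} [NormedAddCommGroup F] [NormedSpace ℝ F]
    {f g h : F → ℝ} (hf : ContDiff ℝ ∞ f) (hg : ContDiff ℝ ∞ g) (hh : ContDiff ℝ ∞ h) :
    ContDiff ℝ ∞ (fun x => invStereo (f x) (g x) (h x)) := by
  have h1 : ContDiff ℝ ∞ (fun x => (1 + (f x ^ 2 + g x ^ 2 + h x ^ 2))⁻¹) :=
    ContDiff.inv (by fun_prop) (fun x => by positivity)
  refine contDiff_quaternion_mk ?_ ?_ ?_ ?_ <;> fun_prop

theorem contDiff_build {F : Type*} [NormedAddCommGroup F] [NormedSpace ℝ F]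
    {c y w : F → ℍ[ℝ]} (hc : ContDiff ℝ ∞ c) (hy : ContDiff ℝ ∞ y) (hw : ContDiff ℝ ∞ w)
    (hy' : ∀ x, Quaternion.normSq (y x) = 1) (hw' : ∀ x, Quaternion.normSq (w x) = 1) :
    ContDiff ℝ ∞ (fun x => (SpOneOne.build (c x) (y x) (w x) (hy' x) (hw' x)).1) := by
  refine contDiff_matrix fun i j => ?_
  fin_cases i <;> fin_cases j <;> simp [SpOneOne.build] <;> fun_prop

theorem SpOneOne.contDiff_param :
    ContDiff ℝ ∞ (fun x => (SpOneOne.param x : Matrix (Fin 2) (Fin 2) ℍ[ℝ])) :=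
  contDiff_build (contDiff_quaternion_mk (contDiff_coord_apply _) (contDiff_coord_apply _) (contDiff_coord_apply _)
    (contDiff_coord_apply _))
    (contDiff_invStereo (contDiff_coord_apply 4) (contDiff_coord_apply 5) (contDiff_coord_apply 6))
    (contDiff_invStereo (contDiff_coord_apply 7) (contDiff_coord_apply 8) (contDiff_coord_apply 9)) _ _

theorem SpOneOne.contDiff_qparam :
    ContDiff ℝ ∞ (fun x => (SpOneOne.qparam x : Matrix (Fin 2) (Fin 2) ℍ[ℝ])) :=
  contDiff_build (contDiff_quaternion_mk (contDiff_coord_apply _) (contDiff_coord_apply _) (contDiff_coord_apply _)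
    (contDiff_coord_apply _))
    (contDiff_invStereo (contDiff_coord_apply 4) (contDiff_coord_apply 5) (contDiff_coord_apply 6))
    contDiff_const _ _

/-- The domain of `SpOneOne.coord`. -/
def SpOneOne.coordDomain : Set (Matrix (Fin 2) (Fin 2) ℍ[ℝ]) :=
  {A | 1 + ((rad (A 0 1))⁻¹ • A 0 0).re ≠ 0 ∧ 1 + ((rad (A 0 1))⁻¹ • A 1 1).re ≠ 0}

/-- The domain of `SpOneOne.qcoord`. -/
def SpOneOne.qcoordDomain : Set (Matrix (Fin 2) (Fin 2) ℍ[ℝ]) :=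
  {A | 1 + (((rad (A 0 1))⁻¹ * (rad (A 0 1))⁻¹) • (A 0 0 * star (A 1 1))).re ≠ 0}

theorem contDiff_inv_rad :
    ContDiff ℝ ∞ (fun A : Matrix (Fin 2) (Fin 2) ℍ[ℝ] => (rad (A 0 1))⁻¹) :=
  ContDiff.inv (contDiff_rad.comp (contDiff_entry 0 1)) fun _ => (rad_pos _).ne'

theorem contDiff_norm_diag (i : Fin 2) :
    ContDiff ℝ ∞ (fun A : Matrix (Fin 2) (Fin 2) ℍ[ℝ] => (rad (A 0 1))⁻¹ • A i i) :=
  contDiff_inv_rad.smul (contDiff_entry i i)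

theorem contDiff_norm_upper :
    ContDiff ℝ ∞ (fun A : Matrix (Fin 2) (Fin 2) ℍ[ℝ] =>
      (rad (A 0 1))⁻¹ • (A 0 1 * star (A 1 1))) :=
  contDiff_inv_rad.smul ((contDiff_entry 0 1).mul
    (contDiff_quaternion_star.comp (contDiff_entry 1 1)))

theorem contDiff_norm_first :
    ContDiff ℝ ∞ (fun A : Matrix (Fin 2) (Fin 2) ℍ[ℝ] =>
      ((rad (A 0 1))⁻¹ * (rad (A 0 1))⁻¹) • (A 0 0 * star (A 1 1))) :=
  (contDiff_inv_rad.mul contDiff_inv_rad).smul ((contDiff_entry 0 0).mul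
    (contDiff_quaternion_star.comp (contDiff_entry 1 1)))

theorem SpOneOne.isOpen_coordDomain : IsOpen SpOneOne.coordDomain :=
  IsOpen.inter
    (isOpen_ne_fun (continuous_const.add (contDiff_quaternion_re.comp
      (contDiff_norm_diag 0)).continuous) continuous_const)
    (isOpen_ne_fun (continuous_const.add (contDiff_quaternion_re.comp
      (contDiff_norm_diag 1)).continuous) continuous_const)

theorem SpOneOne.isOpen_qcoordDomain : IsOpen SpOneOne.qcoordDomain :=
  isOpen_ne_fun (continuous_const.add (contDiff_quaternion_re.comp
    contDiff_norm_first).continuous) continuous_const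

theorem contDiffOn_stereoCoord {F : Type*} [NormedAddCommGroup F] [NormedSpace ℝ F]
    {f : F → ℍ[ℝ]} (hf : ContDiff ℝ ∞ f) {U : Set F} (hU : ∀ x ∈ U, 1 + (f x).re ≠ 0) (i : Fin 3) :
    ContDiffOn ℝ ∞ (fun x => stereoCoord (f x) i) U := by
  fin_cases i <;> simp [stereoCoord] <;>
    exact ContDiffOn.div (by fun_prop) (by fun_prop) hU

theorem SpOneOne.contDiffOn_coord :
    ContDiffOn ℝ ∞ SpOneOne.coord SpOneOne.coordDomain := by
  rw [contDiffOn_euclidean]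
  have hp := contDiffOn_stereoCoord (U := SpOneOne.coordDomain)
    (contDiff_norm_diag 0) (fun x hx => hx.1)
  have hq := contDiffOn_stereoCoord (U := SpOneOne.coordDomain)
    (contDiff_norm_diag 1) (fun x hx => hx.2)
  intro i
  fin_cases i
  · exact (contDiff_quaternion_re.comp (contDiff_entry 0 1)).contDiffOn
  · exact (contDiff_quaternion_imI.comp (contDiff_entry 0 1)).contDiffOn
  · exact (contDiff_quaternion_imJ.comp (contDiff_entry 0 1)).contDiffOn
  · exact (contDiff_quaternion_imK.comp (contDiff_entry 0 1)).contDiffOn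
  · exact hp 0
  · exact hp 1
  · exact hp 2
  · exact hq 0
  · exact hq 1
  · exact hq 2

theorem SpOneOne.contDiffOn_qcoord :
    ContDiffOn ℝ ∞ SpOneOne.qcoord SpOneOne.qcoordDomain := by
  rw [contDiffOn_euclidean]
  have hp := contDiffOn_stereoCoord (U := SpOneOne.qcoordDomain)
    contDiff_norm_first (fun x hx => hx)
  have hc := contDiff_norm_upper
  intro i
  fin_cases i
  · exact (contDiff_quaternion_re.comp hc).contDiffOn
  · exact (contDiff_quaternion_imI.comp hc).contDiffOn
  · exact (contDiff_quaternion_imJ.comp hc).contDiffOn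
  · exact (contDiff_quaternion_imK.comp hc).contDiffOn
  · exact hp 0
  · exact hp 1
  · exact hp 2

theorem SpOneOne.ext_norm {A B : SpOneOne} (h1 : A.1 0 1 = B.1 0 1)
    (h0 : (rad (A.1 0 1))⁻¹ • A.1 0 0 = (rad (B.1 0 1))⁻¹ • B.1 0 0)
    (h2 : (rad (A.1 0 1))⁻¹ • A.1 1 1 = (rad (B.1 0 1))⁻¹ • B.1 1 1) : A = B := by
  have hr : (rad (B.1 0 1))⁻¹ ≠ 0 := inv_ne_zero (rad_pos _).ne'
  rw [h1] at h0 h2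
  exact SpOneOne.ext' (smul_right_injective _ hr h0) h1 (smul_right_injective _ hr h2)

theorem SpOneOne.normSq_diag (A : SpOneOne) :
    Quaternion.normSq ((rad (A.1 0 1))⁻¹ • A.1 0 0) = 1 ∧
      Quaternion.normSq ((rad (A.1 0 1))⁻¹ • A.1 1 1) = 1 := by
  obtain ⟨h1, h0, -⟩ := SpOneOne.rel A.2
  have hr := (rad_pos (A.1 0 1)).ne'
  rw [Quaternion.normSq_smul, Quaternion.normSq_smul, h0, h1, ← rad_sq]
  constructor <;> field_simp

theorem SpOneOne.build_norm (c y w : ℍ[ℝ]) (hy : Quaternion.normSq y = 1)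
    (hw : Quaternion.normSq w = 1) :
    (SpOneOne.build c y w hy hw).1 0 1 = c ∧
    (rad c)⁻¹ • (SpOneOne.build c y w hy hw).1 0 0 = y ∧
    (rad c)⁻¹ • (SpOneOne.build c y w hy hw).1 1 1 = w := by
  have hr := (rad_pos c).ne'
  refine ⟨rfl, ?_, ?_⟩ <;> simp [SpOneOne.build, smul_smul, inv_mul_cancel₀ hr]

theorem stereoCoord_invStereo (r s t : ℝ) : stereoCoord (invStereo r s t) = ![r, s, t] := by
  have h := one_add_re_invStereo r s t
  have : 1 + (r ^ 2 + s ^ 2 + t ^ 2) ≠ 0 := by positivity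
  unfold stereoCoord
  rw [h]
  funext i
  fin_cases i <;> simp [invStereo] <;> field_simp

theorem SpOneOne.param_coord (A : SpOneOne) (hA : A.1 ∈ SpOneOne.coordDomain) :
    SpOneOne.param (SpOneOne.coord A.1) = A := by
  obtain ⟨hp, hq⟩ := SpOneOne.normSq_diag A
  obtain ⟨h1, h0, h2⟩ := SpOneOne.build_norm (A.1 0 1) _ _ hp hq
  have key : SpOneOne.param (SpOneOne.coord A.1) = SpOneOne.build (A.1 0 1) _ _ hp hq := by
    have e1 := invStereo_stereo _ hp hA.1
    have e2 := invStereo_stereo _ hq hA.2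
    unfold SpOneOne.param
    congr 1
  rw [key]
  exact SpOneOne.ext_norm h1 h0 h2

theorem SpOneOne.param_mem (x : EuclideanSpace ℝ (Fin 10)) :
    (SpOneOne.param x).1 ∈ SpOneOne.coordDomain := by
  obtain ⟨h1, h0, h2⟩ := SpOneOne.build_norm ⟨x 0, x 1, x 2, x 3⟩ _ _
    (normSq_invStereo (x 4) (x 5) (x 6)) (normSq_invStereo (x 7) (x 8) (x 9))
  constructor
  · change 1 + ((rad (⟨x 0, x 1, x 2, x 3⟩))⁻¹ • (SpOneOne.build _ _ _ _ _).1 0 0).re ≠ 0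
    rw [h0, one_add_re_invStereo]
    positivity
  · change 1 + ((rad (⟨x 0, x 1, x 2, x 3⟩))⁻¹ • (SpOneOne.build _ _ _ _ _).1 1 1).re ≠ 0
    rw [h2, one_add_re_invStereo]
    positivity

theorem SpOneOne.coord_param (x : EuclideanSpace ℝ (Fin 10)) :
    SpOneOne.coord (SpOneOne.param x).1 = x := by
  obtain ⟨h1, h0, h2⟩ := SpOneOne.build_norm ⟨x 0, x 1, x 2, x 3⟩ _ _
    (normSq_invStereo (x 4) (x 5) (x 6)) (normSq_invStereo (x 7) (x 8) (x 9))
  have e0 : stereoCoord ((rad ((SpOneOne.param x).1 0 1))⁻¹ • (SpOneOne.param x).1 0 0) =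
      ![x 4, x 5, x 6] := by
    rw [← stereoCoord_invStereo]; exact congrArg stereoCoord h0
  have e2 : stereoCoord ((rad ((SpOneOne.param x).1 0 1))⁻¹ • (SpOneOne.param x).1 1 1) =
      ![x 7, x 8, x 9] := by
    rw [← stereoCoord_invStereo]; exact congrArg stereoCoord h2
  have e1 : (SpOneOne.param x).1 0 1 = ⟨x 0, x 1, x 2, x 3⟩ := h1
  ext i
  simp only [SpOneOne.coord, e0, e2]
  fin_cases i <;> simp [e1]

/-- The chart of `Sp(1,1)` near the identity given by `SpOneOne.coord`. -/
def SpOneOne.chartOne : OpenPartialHomeomorph SpOneOne (EuclideanSpace ℝ (Fin 10)) where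
  toFun A := SpOneOne.coord A.1
  invFun := SpOneOne.param
  source := {A | A.1 ∈ SpOneOne.coordDomain}
  target := univ
  map_source' _ _ := mem_univ _
  map_target' x _ := SpOneOne.param_mem x
  left_inv' A hA := SpOneOne.param_coord A hA
  right_inv' x _ := SpOneOne.coord_param x
  open_source := SpOneOne.isOpen_coordDomain.preimage continuous_subtype_val
  open_target := isOpen_univ
  continuousOn_toFun :=
    SpOneOne.contDiffOn_coord.continuousOn.comp continuous_subtype_val.continuousOn fun _ h => h
  continuousOn_invFun :=
    (Continuous.subtype_mk SpOneOne.contDiff_param.continuous _).continuousOn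

theorem contDiff_mulLeft (B : Matrix (Fin 2) (Fin 2) ℍ[ℝ]) : ContDiff ℝ ∞ (fun A => B * A) :=
  (LinearMap.mulLeft ℝ B).toContinuousLinearMap.contDiff

theorem SpOneOne.exists_chart (g : SpOneOne) :
    ∃ e ∈ submanifoldAtlas SpOneOne (EuclideanSpace ℝ (Fin 10)), g ∈ e.source := by
  refine ⟨(Homeomorph.mulLeft g⁻¹).transOpenPartialHomeomorph SpOneOne.chartOne, ⟨?_, ?_⟩, ?_⟩
  · exact ((contDiff_mulLeft (g⁻¹)⁻¹.1).comp SpOneOne.contDiff_param).contDiffOn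
  · intro x hx
    exact ⟨_, fun A => SpOneOne.coord ((g⁻¹).1 * A),
      SpOneOne.isOpen_coordDomain.preimage (contDiff_mulLeft (g⁻¹).1).continuous, hx,
      SpOneOne.contDiffOn_coord.comp (contDiff_mulLeft (g⁻¹).1).contDiffOn fun _ h => h,
      fun _ _ _ => rfl⟩
  · change ((g⁻¹ * g : SpOneOne) : Matrix (Fin 2) (Fin 2) ℍ[ℝ]) ∈ SpOneOne.coordDomain
    rw [inv_mul_cancel, SpOneOne.coe_one]
    constructor <;> simp [rad]

/-- `Sp(1,1)` as an embedded submanifold of the space of `2 × 2` quaternionic matrices. -/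
instance : ChartedSpace (EuclideanSpace ℝ (Fin 10)) SpOneOne :=
  submanifoldChartedSpace SpOneOne SpOneOne.exists_chart

instance : IsManifold (𝓡 10) ∞ SpOneOne :=
  submanifold_isManifold SpOneOne SpOneOne.exists_chart

/-- The restriction to `Sp(1,1)` of a smooth map on the space of matrices is smooth. -/
theorem SpOneOne.contMDiffOn_restrict {F : Type*} [NormedAddCommGroup F] [NormedSpace ℝ F]
    {U : Set (Matrix (Fin 2) (Fin 2) ℍ[ℝ])} {f : Matrix (Fin 2) (Fin 2) ℍ[ℝ] → F}
    (hf : ContDiffOn ℝ ∞ f U) :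
    ContMDiffOn (𝓡 10) 𝓘(ℝ, F) ∞ (fun A : SpOneOne => f A.1) {A : SpOneOne | A.1 ∈ U} :=
  submanifold_contMDiffOn_restrict SpOneOne SpOneOne.exists_chart hf

/-- A map into `Sp(1,1)` that is smooth as a map into the space of matrices is smooth. -/
theorem SpOneOne.contMDiffOn_of_coe {F : Type*} [NormedAddCommGroup F] [NormedSpace ℝ F]
    {U : Set F} (hU : IsOpen U) {σ : F → SpOneOne}
    (hσ : ContDiffOn ℝ ∞ (fun x => (σ x).1) U) : ContMDiffOn 𝓘(ℝ, F) (𝓡 10) ∞ σ U :=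
  submanifold_contMDiffOn_of_coe SpOneOne SpOneOne.exists_chart hU hσ

/-- The projection `Sp(1,1) → Sp(1,1) / Sp(1) I₂`. -/
def SpOneOne.proj (A : SpOneOne) : SpOneOne ⧸ spOneScalar := QuotientGroup.mk A

theorem SpOneOne.mul_scalar {k : SpOneOne} {u : ℍ[ℝ]} (hk : k.1 = Matrix.diagonal fun _ => u)
    (A : SpOneOne) (i j : Fin 2) : (A * k).1 i j = A.1 i j * u := by
  rw [SpOneOne.coe_mul, hk, Matrix.mul_diagonal]

theorem SpOneOne.q_invariant {u : ℍ[ℝ]} (hu : ‖u‖ = 1) {A B : Matrix (Fin 2) (Fin 2) ℍ[ℝ]}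
    (h : ∀ i j, B i j = A i j * u) :
    rad (B 0 1) = rad (A 0 1) ∧ B 0 1 * star (B 1 1) = A 0 1 * star (A 1 1) ∧
      B 0 0 * star (B 1 1) = A 0 0 * star (A 1 1) := by
  have hu' : u * star u = 1 := by
    rw [Quaternion.self_mul_star, Quaternion.normSq_eq_norm_mul_self, hu]; simp
  have hn : Quaternion.normSq u = 1 := by rw [Quaternion.normSq_eq_norm_mul_self, hu]; simp
  refine ⟨?_, ?_, ?_⟩
  · simp [rad, h, hn]
  · rw [h, h, star_mul, mul_assoc, ← mul_assoc u, hu', one_mul]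
  · rw [h, h, star_mul, mul_assoc, ← mul_assoc u, hu', one_mul]

theorem SpOneOne.proj_rel {A B : SpOneOne} (h : SpOneOne.proj A = SpOneOne.proj B) :
    ∃ u : ℍ[ℝ], ‖u‖ = 1 ∧ ∀ i j, B.1 i j = A.1 i j * u := by
  obtain ⟨u, hu, hk⟩ := QuotientGroup.eq.1 h
  refine ⟨u, hu, fun i j => ?_⟩
  rw [← SpOneOne.mul_scalar hk, mul_inv_cancel_left]

theorem SpOneOne.qcoord_eq {A B : SpOneOne} (h : SpOneOne.proj A = SpOneOne.proj B) :
    SpOneOne.qcoord A.1 = SpOneOne.qcoord B.1 := by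
  obtain ⟨u, hu, hB⟩ := SpOneOne.proj_rel h
  obtain ⟨h1, h2, h3⟩ := SpOneOne.q_invariant hu hB
  simp only [SpOneOne.qcoord, h1, h2, h3]

theorem SpOneOne.qdomain_iff {A B : SpOneOne} (h : SpOneOne.proj A = SpOneOne.proj B) :
    A.1 ∈ SpOneOne.qcoordDomain ↔ B.1 ∈ SpOneOne.qcoordDomain := by
  obtain ⟨u, hu, hB⟩ := SpOneOne.proj_rel h
  obtain ⟨h1, h2, h3⟩ := SpOneOne.q_invariant hu hB
  simp only [SpOneOne.qcoordDomain, mem_ofPred_eq, h1, h3]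

theorem SpOneOne.qcoord_qparam (x : EuclideanSpace ℝ (Fin 7)) :
    (SpOneOne.qparam x).1 ∈ SpOneOne.qcoordDomain ∧
      SpOneOne.qcoord (SpOneOne.qparam x).1 = x := by
  obtain ⟨h1, h0, h2⟩ := SpOneOne.build_norm ⟨x 0, x 1, x 2, x 3⟩ _ 1
    (normSq_invStereo (x 4) (x 5) (x 6)) (by simp)
  set A := SpOneOne.qparam x with hA
  have e1 : A.1 0 1 = ⟨x 0, x 1, x 2, x 3⟩ := h1
  have e0 : (rad (A.1 0 1))⁻¹ • A.1 0 0 = invStereo (x 4) (x 5) (x 6) := h0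
  have e2 : (rad (A.1 0 1))⁻¹ • star (A.1 1 1) = 1 := by
    have : (rad (A.1 0 1))⁻¹ • A.1 1 1 = 1 := h2
    have := congrArg star this
    simpa [Quaternion.star_smul] using this
  have f1 : (rad (A.1 0 1))⁻¹ • (A.1 0 1 * star (A.1 1 1)) = A.1 0 1 := by
    rw [← mul_smul_comm, e2, mul_one]
  have f0 : ((rad (A.1 0 1))⁻¹ * (rad (A.1 0 1))⁻¹) • (A.1 0 0 * star (A.1 1 1)) =
      invStereo (x 4) (x 5) (x 6) := by
    rw [← smul_mul_smul_comm, e2, mul_one, e0]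
  constructor
  · change 1 + (((rad (A.1 0 1))⁻¹ * (rad (A.1 0 1))⁻¹) • (A.1 0 0 * star (A.1 1 1))).re ≠ 0
    rw [f0, one_add_re_invStereo]
    positivity
  · ext i
    simp only [SpOneOne.qcoord, f0, f1, stereoCoord_invStereo]
    fin_cases i <;> simp [e1]

theorem SpOneOne.proj_qparam_qcoord (A : SpOneOne) (hA : A.1 ∈ SpOneOne.qcoordDomain) :
    SpOneOne.proj (SpOneOne.qparam (SpOneOne.qcoord A.1)) = SpOneOne.proj A := by
  obtain ⟨hp, hq⟩ := SpOneOne.normSq_diag A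
  have hr := (rad_pos (A.1 0 1)).ne'
  set r := rad (A.1 0 1) with hrdef
  set u : ℍ[ℝ] := star (r⁻¹ • A.1 1 1) with hu
  have hu1 : Quaternion.normSq u = 1 := by rw [hu, Quaternion.normSq_star]; exact hq
  have hu2 : ‖u‖ = 1 := by
    have : ‖u‖ * ‖u‖ = 1 := by rw [← Quaternion.normSq_eq_norm_mul_self]; exact hu1
    nlinarith [norm_nonneg u]
  have hus : star u * u = 1 := by rw [Quaternion.star_mul_self, hu1]; rfl
  have hkm : (Matrix.diagonal fun _ => u : Matrix (Fin 2) (Fin 2) ℍ[ℝ]) ∈ SpOneOne := by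
    change _ * _ * _ = _
    rw [Matrix.diagonal_conjTranspose, mul_assoc]
    ext1 i j
    fin_cases i <;> fin_cases j <;>
      simp [signatureMatrix, hus]
  set k : SpOneOne := ⟨_, hkm⟩ with hk
  have hkK : k ∈ spOneScalar := ⟨u, hu2, rfl⟩
  have hAk : ∀ i j, (A * k).1 i j = A.1 i j * u := SpOneOne.mul_scalar rfl A
  have hu' : u = r⁻¹ • star (A.1 1 1) := by rw [hu, Quaternion.star_smul]
  obtain ⟨i1, -, -⟩ := SpOneOne.q_invariant hu2 hAk
  have k1 : (A * k).1 0 1 = r⁻¹ • (A.1 0 1 * star (A.1 1 1)) := by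
    rw [hAk, hu', mul_smul_comm]
  have k0 : (rad ((A * k).1 0 1))⁻¹ • (A * k).1 0 0 =
      (r⁻¹ * r⁻¹) • (A.1 0 0 * star (A.1 1 1)) := by
    rw [i1, hAk, hu', mul_smul_comm, smul_smul]
  have k2 : (rad ((A * k).1 0 1))⁻¹ • (A * k).1 1 1 = 1 := by
    rw [i1, hAk, ← smul_mul_assoc, hu, Quaternion.self_mul_star, hq]; rfl
  have hp' : Quaternion.normSq ((r⁻¹ * r⁻¹) • (A.1 0 0 * star (A.1 1 1))) = 1 := by
    rw [← k0]; exact (SpOneOne.normSq_diag (A * k)).1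
  have e1 := invStereo_stereo _ hp' hA
  obtain ⟨h1, h0, h2⟩ := SpOneOne.build_norm (r⁻¹ • (A.1 0 1 * star (A.1 1 1))) _ 1 hp' (by simp)
  have key : SpOneOne.qparam (SpOneOne.qcoord A.1) =
      SpOneOne.build (r⁻¹ • (A.1 0 1 * star (A.1 1 1))) _ 1 hp' (by simp) := by
    unfold SpOneOne.qparam
    congr 1
  have : SpOneOne.qparam (SpOneOne.qcoord A.1) = A * k := by
    rw [key]
    refine SpOneOne.ext_norm (h1.trans k1.symm) ?_ ?_
    · rw [k0]; exact h0
    · rw [k2]; exact h2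
  rw [this]
  exact (QuotientGroup.eq.2 (by simpa using hkK)).symm

/-- The chart of `Sp(1,1) / Sp(1) I₂` near the class of the identity. -/
def SpOneOne.qchartOne :
    OpenPartialHomeomorph (SpOneOne ⧸ spOneScalar) (EuclideanSpace ℝ (Fin 7)) where
  toFun := fun x => SpOneOne.qcoord x.out.1
  invFun x := SpOneOne.proj (SpOneOne.qparam x)
  source := {x | x.out.1 ∈ SpOneOne.qcoordDomain}
  target := univ
  map_source' _ _ := mem_univ _
  map_target' x _ :=
    (SpOneOne.qdomain_iff (QuotientGroup.out_eq' (SpOneOne.proj (SpOneOne.qparam x)))).2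
      (SpOneOne.qcoord_qparam x).1
  left_inv' x hx := (SpOneOne.proj_qparam_qcoord x.out hx).trans (QuotientGroup.out_eq' x)
  right_inv' x _ :=
    (SpOneOne.qcoord_eq (QuotientGroup.out_eq' (SpOneOne.proj (SpOneOne.qparam x)))).trans
      (SpOneOne.qcoord_qparam x).2
  open_source := by
    refine (QuotientGroup.isQuotientMap_mk (N := spOneScalar)).isOpen_preimage.1 ?_
    convert SpOneOne.isOpen_qcoordDomain.preimage continuous_subtype_val using 1
    ext A
    exact SpOneOne.qdomain_iff (QuotientGroup.out_eq' (SpOneOne.proj A))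
  open_target := isOpen_univ
  continuousOn_toFun := by
    have hop : IsOpen {x : SpOneOne ⧸ spOneScalar | x.out.1 ∈ SpOneOne.qcoordDomain} := by
      refine (QuotientGroup.isQuotientMap_mk (N := spOneScalar)).isOpen_preimage.1 ?_
      convert SpOneOne.isOpen_qcoordDomain.preimage continuous_subtype_val using 1
      ext A
      exact SpOneOne.qdomain_iff (QuotientGroup.out_eq' (SpOneOne.proj A))
    refine ((QuotientGroup.isQuotientMap_mk (N := spOneScalar)).continuousOn_isOpen_iff hop).2 ?_
    refine (SpOneOne.contDiffOn_qcoord.continuousOn.comp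
      continuous_subtype_val.continuousOn ?_).congr ?_ (f := fun A : SpOneOne => SpOneOne.qcoord A.1)
    · exact fun A hA => (SpOneOne.qdomain_iff (QuotientGroup.out_eq' (SpOneOne.proj A))).1 hA
    · exact fun A _ => SpOneOne.qcoord_eq (QuotientGroup.out_eq' (SpOneOne.proj A))
  continuousOn_invFun :=
    (continuous_quotient_mk'.comp
      (Continuous.subtype_mk SpOneOne.contDiff_qparam.continuous _)).continuousOn

theorem SpOneOne.exists_qchart (x : SpOneOne ⧸ spOneScalar) :
    ∃ e ∈ quotientAtlas (EuclideanSpace ℝ (Fin 10)) (EuclideanSpace ℝ (Fin 7)) SpOneOne.proj,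
      x ∈ e.source := by
  obtain ⟨g, rfl⟩ := QuotientGroup.mk_surjective x
  have hout : ∀ A : SpOneOne, SpOneOne.proj ((g⁻¹ • SpOneOne.proj A).out) =
      SpOneOne.proj (g⁻¹ * A) := fun A => QuotientGroup.out_eq' _
  refine ⟨(Homeomorph.smul g⁻¹).transOpenPartialHomeomorph SpOneOne.qchartOne, ⟨?_, ?_⟩, ?_⟩
  · have h1 : ContDiffOn ℝ ∞ (SpOneOne.qcoord ∘ fun A => (g⁻¹).1 * A)
        ((fun A => (g⁻¹).1 * A) ⁻¹' SpOneOne.qcoordDomain) :=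
      SpOneOne.contDiffOn_qcoord.comp (contDiff_mulLeft (g⁻¹).1).contDiffOn
        (mapsTo_preimage _ _)
    have h2 := SpOneOne.contMDiffOn_restrict h1
    refine (h2.mono ?_).congr ?_
    · intro A hA
      exact (SpOneOne.qdomain_iff (hout A)).1 hA
    · intro A _
      have h3 : SpOneOne.qcoord (g⁻¹ • SpOneOne.proj A).out.1 = SpOneOne.qcoord (g⁻¹ * A).1 :=
        SpOneOne.qcoord_eq (hout A)
      rw [SpOneOne.coe_mul] at h3
      exact h3
  · intro y _
    refine ⟨univ, fun z => (g⁻¹)⁻¹ * SpOneOne.qparam z, isOpen_univ, mem_univ _, fun z _ => mem_univ _,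
      ?_, fun _ _ => rfl⟩
    refine SpOneOne.contMDiffOn_of_coe isOpen_univ ?_
    exact ((contDiff_mulLeft (g⁻¹)⁻¹.1).comp SpOneOne.contDiff_qparam).contDiffOn
  · refine (SpOneOne.qdomain_iff (hout g)).2 ?_
    rw [inv_mul_cancel, SpOneOne.coe_one]
    change (1 : ℝ) + _ ≠ 0
    simp [rad]

/-- The quotient `Sp(1,1) / Sp(1) I₂` as the base of the submersion `Sp(1,1) → Sp(1,1) / Sp(1) I₂`. -/
instance : ChartedSpace (EuclideanSpace ℝ (Fin 7)) (SpOneOne ⧸ spOneScalar) :=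
  quotientChartedSpace SpOneOne.proj SpOneOne.exists_qchart

instance : IsManifold (𝓡 7) ∞ (SpOneOne ⧸ spOneScalar) :=
  quotient_isManifold SpOneOne.proj continuous_quotient_mk' SpOneOne.exists_qchart

/-! ### Slice regular functions and regular Möbius transformations -/

/-- The open unit ball of the quaternions. -/
def unitBall : TopologicalSpace.Opens ℍ[ℝ] := ⟨Metric.ball 0 1, Metric.isOpen_ball⟩

/-- `f` has the power series expansion `f q = ∑ qⁿ aₙ` on the unit ball. The slice regular functions
on the unit ball are exactly the functions that have such an expansion. -/
def HasRegularExpansion (f : unitBall → ℍ[ℝ]) (a : ℕ → ℍ[ℝ]) : Prop :=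
  ∀ q : unitBall, HasSum (fun n => (q : ℍ[ℝ]) ^ n * a n) (f q)

open Classical in
/-- The coefficients of the power series expansion of a slice regular function (and `0` for a
function without expansion). -/
def regularCoeff (f : unitBall → ℍ[ℝ]) : ℕ → ℍ[ℝ] :=
  if h : ∃ a, HasRegularExpansion f a then h.choose else 0

theorem HasRegularExpansion.unique {f : unitBall → ℍ[ℝ]} {a b : ℕ → ℍ[ℝ]}
    (ha : HasRegularExpansion f a) (hb : HasRegularExpansion f b) : a = b := by
  classical
  have key : ∀ c : ℕ → ℍ[ℝ], HasRegularExpansion f c → HasFPowerSeriesAt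
      (fun x : ℝ => if h : (x : ℍ[ℝ]) ∈ unitBall then f ⟨x, h⟩ else 0)
      (fun n => ContinuousMultilinearMap.mkPiRing ℝ (Fin n) (c n) :
        FormalMultilinearSeries ℝ ℝ ℍ[ℝ]) 0 := by
    intro c hc
    refine hasFPowerSeriesAt_iff.2 ?_
    have hmem : ∀ᶠ x : ℝ in 𝓝 0, (x : ℍ[ℝ]) ∈ unitBall :=
      (Quaternion.continuous_coe.tendsto 0).eventually
        (unitBall.isOpen.mem_nhds (by simp [unitBall]))
    filter_upwards [hmem] with x hx
    have := hc ⟨x, hx⟩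
    simp only [zero_add, hx, dite_true]
    have hn : (fun n => ((⟨x, hx⟩ : unitBall) : ℍ[ℝ]) ^ n * c n) = fun n => x ^ n • c n := by
      funext n
      rw [← Quaternion.coe_mul_eq_smul, Quaternion.coe_pow]
    rw [hn] at this
    simpa [FormalMultilinearSeries.coeff] using this
  have h := (key a ha).eq_formalMultilinearSeries (key b hb)
  funext n
  have := congrArg (fun p => p n (fun _ => (1 : ℝ))) h
  simpa using this

theorem HasRegularExpansion.regularCoeff_eq {f : unitBall → ℍ[ℝ]} {a : ℕ → ℍ[ℝ]}
    (ha : HasRegularExpansion f a) : regularCoeff f = a := by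
  have h : ∃ a, HasRegularExpansion f a := ⟨a, ha⟩
  rw [regularCoeff, dif_pos h]
  exact h.choose_spec.unique ha

/-- The regular product `f * g`. -/
def starMul (f g : unitBall → ℍ[ℝ]) : unitBall → ℍ[ℝ] := fun q =>
  ∑' n : ℕ, (q : ℍ[ℝ]) ^ n * ∑ k ∈ Finset.range (n + 1), regularCoeff f k * regularCoeff g (n - k)

/-- The regular conjugate `f^c`. -/
def regularConj (f : unitBall → ℍ[ℝ]) : unitBall → ℍ[ℝ] := fun q =>
  ∑' n : ℕ, (q : ℍ[ℝ]) ^ n * star (regularCoeff f n)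

/-- The symmetrization `f^s = f * f^c`. -/
def symmetrization (f : unitBall → ℍ[ℝ]) : unitBall → ℍ[ℝ] := starMul f (regularConj f)

/-- The regular reciprocal `f^{-*} = (1 / f^s) f^c`. It is meaningful when `f^s` has no zeros. -/
def starInv (f : unitBall → ℍ[ℝ]) : unitBall → ℍ[ℝ] := fun q =>
  (symmetrization f q)⁻¹ * regularConj f q

/-- The function `q ↦ q a + b`. -/
def regularLinear (a b : ℍ[ℝ]) : unitBall → ℍ[ℝ] := fun q => q * a + b

/-- The regular Möbius transformation `(q c + d)^{-*} * (q a + b)` of the matrix with rows `(a, c)`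
and `(b, d)`. -/
def regularMobius (A : Matrix (Fin 2) (Fin 2) ℍ[ℝ]) : unitBall → ℍ[ℝ] :=
  starMul (starInv (regularLinear (A 0 1) (A 1 1))) (regularLinear (A 0 0) (A 1 0))

/-- The family `𝓜(𝔹)` of all regular Möbius transformations of the unit ball. -/
def RegularMobius : Type :=
  {f : unitBall → ℍ[ℝ] // ∃ A : SpOneOne, f = regularMobius A.1}

/-- The function `q ↦ (1 - q ā)^{-*} * (q - a) u` on the unit ball. -/
def mobiusParam (a u : ℍ[ℝ]) : unitBall → ℍ[ℝ] :=
  starMul (starInv fun q => 1 - q * star a) fun q => (q - a) * u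

/-- A manifold structure on `𝓜(𝔹)` is the one induced by `Sp(1,1) / Sp(1) I₂` if
`A Sp(1) I₂ ↦ 𝓕_{A⁻¹}` is a well-defined diffeomorphism onto `𝓜(𝔹)`. -/
def IsInducedStructure [TopologicalSpace RegularMobius]
    [ChartedSpace (EuclideanSpace ℝ (Fin 7)) RegularMobius] : Prop :=
  IsManifold (𝓡 7) ∞ RegularMobius ∧
    ∃ Ψ : (SpOneOne ⧸ spOneScalar) ≃ₘ⟮𝓡 7, 𝓡 7⟯ RegularMobius,
      ∀ A : SpOneOne, (Ψ (SpOneOne.proj A)).1 = regularMobius (A⁻¹ : SpOneOne).1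

/-- The quaternions have real dimension `3 + 1`. -/
instance : Fact (Module.finrank ℝ ℍ[ℝ] = 3 + 1) := ⟨Quaternion.finrank_eq_four⟩

end

/-!
A matrix `A ∈ Sp(1,1)` with rows `(a, c)` and `(b, d)` is determined by `p = b d⁻¹ ∈ 𝔹`,
`u ∈ Sp(1)` with `ū = a d⁻¹`, and `d`: its rows are `(ū d, ū p̄ d)` and `(p d, d)`, where
`|d|² = 1 / (1 - |p|²)`. Right multiplication by `Sp(1) I₂` only changes the argument of `d`, hence
`(p, u)` are coordinates on `Sp(1,1) / Sp(1) I₂`, and choosing `d > 0` gives a global smooth section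
of the projection, which is therefore a trivial bundle over `𝔹 × Sp(1)`.

Power series in a central variable turn the regular product into an ordinary product, and
`f^{-*}` into the inverse series. The rows of `A⁻¹` are `(d̄ u, -d̄ p̄)` and `(-d̄ p u, d̄)`, so
that the factors `d̄` cancel in `𝓕_{A⁻¹} = (1 - q p̄)^{-*} * (q - p) u`. The first two coefficients
of this series are `-p u` and `(1 - |p|²) u`, and they determine `p` and `u`. It follows that the
manifold structure transported along `A Sp(1) I₂ ↦ 𝓕_{A⁻¹}` turns `φ` into the diffeomorphism above.
-/

noncomputable section

section Transport

variable {𝕜 E H X Y : Type*} [NontriviallyNormedField 𝕜] [NormedAddCommGroup E] [NormedSpace 𝕜 E]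
  [TopologicalSpace H] {I : ModelWithCorners 𝕜 E H} {n : ℕ∞ω}
  [TopologicalSpace X] [ChartedSpace H X] [TopologicalSpace Y]

/-- The charted space structure on `Y` whose charts are those of `X` carried over by a homeomorphism
`f : X ≃ₜ Y`. In contrast to `Homeomorph.chartedSpace`, the charts are defined without choice, so
that the transition maps of `Y` are literally those of `X`. -/
@[reducible]
def transportChartedSpace (f : X ≃ₜ Y) : ChartedSpace H Y where
  atlas := f.symm.transOpenPartialHomeomorph '' atlas H X
  chartAt y := f.symm.transOpenPartialHomeomorph (chartAt H (f.symm y))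
  mem_chart_source y := mem_chart_source H (f.symm y)
  chart_mem_atlas y := mem_image_of_mem _ (chart_mem_atlas H (f.symm y))

theorem hasGroupoid_transport (G : StructureGroupoid H) [HasGroupoid X G] (f : X ≃ₜ Y) :
    letI := transportChartedSpace (H := H) f
    HasGroupoid Y G := by
  let _ := transportChartedSpace (H := H) f
  refine ⟨?_⟩
  rintro _ _ ⟨e, he, rfl⟩ ⟨e', he', rfl⟩
  have : (f.symm.transOpenPartialHomeomorph e).symm ≫ₕ f.symm.transOpenPartialHomeomorph e' =
      e.symm ≫ₕ e' := by ext <;> simp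
  exact this ▸ G.compatible he he'

theorem isManifold_transport [IsManifold I n X] (f : X ≃ₜ Y) :
    letI := transportChartedSpace (H := H) f
    IsManifold I n Y :=
  letI := transportChartedSpace (H := H) f
  { hasGroupoid_transport (contDiffGroupoid n I) f with }

theorem contMDiff_transport [IsManifold I n X] (f : X ≃ₜ Y) :
    letI := transportChartedSpace (H := H) f
    ContMDiff I I n f := by
  let _ := transportChartedSpace (H := H) f
  have := isManifold_transport (I := I) (n := n) f
  intro x
  have hx := mem_chart_source H x
  have he : f.symm.transOpenPartialHomeomorph (chartAt H x) ∈ IsManifold.maximalAtlas I n Y :=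
    IsManifold.subset_maximalAtlas (mem_image_of_mem _ (chart_mem_atlas H x))
  refine ((contMDiffAt_symm_of_mem_maximalAtlas he ((chartAt H x).map_source hx)).comp x
    (contMDiffAt_of_mem_maximalAtlas (IsManifold.chart_mem_maximalAtlas x) hx))
      |>.congr_of_eventuallyEq ?_
  filter_upwards [(chartAt H x).open_source.mem_nhds hx] with z hz
  exact congrArg f ((chartAt H x).left_inv hz).symm

theorem contMDiff_transport_symm [IsManifold I n X] (f : X ≃ₜ Y) :
    letI := transportChartedSpace (H := H) f
    ContMDiff I I n f.symm := by
  let _ := transportChartedSpace (H := H) f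
  have := isManifold_transport (I := I) (n := n) f
  intro y
  have hy := mem_chart_source H (f.symm y)
  refine ((contMDiffAt_symm_of_mem_maximalAtlas (IsManifold.chart_mem_maximalAtlas (f.symm y))
    ((chartAt H (f.symm y)).map_source hy)).comp y (contMDiffAt_of_mem_maximalAtlas
      (IsManifold.chart_mem_maximalAtlas y) (mem_chart_source H y))).congr_of_eventuallyEq ?_
  filter_upwards [(chartAt H y).open_source.mem_nhds (mem_chart_source H y)] with z hz
  exact ((chartAt H (f.symm y)).left_inv hz).symm

/-- A homeomorphism as a diffeomorphism onto its codomain with the transported manifold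
structure. -/
def transportDiffeomorph (I : ModelWithCorners 𝕜 E H) (n : ℕ∞ω) [IsManifold I n X] (f : X ≃ₜ Y) :
    letI := transportChartedSpace (H := H) f
    X ≃ₘ^n⟮I, I⟯ Y :=
  letI := transportChartedSpace (H := H) f
  { toEquiv := f.toEquiv
    contMDiff_toFun := contMDiff_transport f
    contMDiff_invFun := contMDiff_transport_symm f }

end Transport

section Submersion

variable {𝕜 E E' H H' M N : Type*} [NontriviallyNormedField 𝕜]
  [NormedAddCommGroup E] [NormedSpace 𝕜 E] [TopologicalSpace H] {I : ModelWithCorners 𝕜 E H}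
  [NormedAddCommGroup E'] [NormedSpace 𝕜 E'] [TopologicalSpace H'] {J : ModelWithCorners 𝕜 E' H'}
  [TopologicalSpace M] [ChartedSpace H M] [TopologicalSpace N] [ChartedSpace H' N]

theorem mfderiv_surjective_of_eventually_rightInverse {f : M → N} {σ : N → M} {x : M}
    (hf : MDifferentiableAt I J f x) (hσ : MDifferentiableAt J I σ (f x)) (hx : σ (f x) = x)
    (h : ∀ᶠ y in 𝓝 (f x), f (σ y) = y) : Function.Surjective (mfderiv I J f x) := by
  have hderiv : (mfderiv I J f (σ (f x))).comp (mfderiv J I σ (f x)) =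
      ContinuousLinearMap.id 𝕜 (TangentSpace J (f x)) :=
    hasMFDerivAt_unique ((hx.symm ▸ hf : MDifferentiableAt I J f (σ (f x))).hasMFDerivAt.comp _
      hσ.hasMFDerivAt) ((hasMFDerivAt_id (f x)).congr_of_eventuallyEq h)
  rw [hx] at hderiv
  exact fun v => ⟨mfderiv J I σ (f x) v, DFunLike.congr_fun hderiv v⟩

end Submersion

section InnerProductSpace

variable (E : Type*) [NormedAddCommGroup E] [InnerProductSpace ℝ E]

/-- The open unit ball of a real inner product space `E` is diffeomorphic to `E`. -/
def unitBallDiffeomorph :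
    (⟨Metric.ball 0 1, Metric.isOpen_ball⟩ : TopologicalSpace.Opens E) ≃ₘ⟮𝓘(ℝ, E), 𝓘(ℝ, E)⟯ E where
  toFun x := OpenPartialHomeomorph.univUnitBall.symm (x : E)
  invFun x := ⟨OpenPartialHomeomorph.univUnitBall x,
    OpenPartialHomeomorph.univUnitBall.map_source (mem_univ x)⟩
  left_inv x := Subtype.ext (OpenPartialHomeomorph.univUnitBall.right_inv x.2)
  right_inv x := OpenPartialHomeomorph.univUnitBall.left_inv (mem_univ x)
  contMDiff_toFun := OpenPartialHomeomorph.contDiffOn_univUnitBall_symm.contMDiffOn.comp_contMDiff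
    contMDiff_subtype_val fun x => x.2
  contMDiff_invFun := (ContMDiff.subtypeVal_comp_iff _ _).1
    OpenPartialHomeomorph.contDiff_univUnitBall.contMDiff

variable {E} {F : Type*} [NormedAddCommGroup F] [InnerProductSpace ℝ F] {m : ℕ}
  [Fact (Module.finrank ℝ E = m + 1)] [Fact (Module.finrank ℝ F = m + 1)]

/-- A linear isometry restricts to a diffeomorphism of unit spheres. -/
def sphereDiffeomorph (n : ℕ∞ω) (e : E ≃ₗᵢ[ℝ] F) :
    Metric.sphere (0 : E) 1 ≃ₘ^n⟮𝓡 m, 𝓡 m⟯ Metric.sphere (0 : F) 1 where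
  toFun x := ⟨e x, by simp⟩
  invFun y := ⟨e.symm y, by simp⟩
  left_inv x := Subtype.ext (e.symm_apply_apply x)
  right_inv y := Subtype.ext (e.apply_symm_apply y)
  contMDiff_toFun := by
    have h : ContMDiff (𝓡 m) 𝓘(ℝ, F) n fun x : Metric.sphere (0 : E) 1 => e x :=
      e.contDiff.contMDiff.comp contMDiff_coe_sphere
    exact h.codRestrict_sphere _
  contMDiff_invFun := by
    have h : ContMDiff (𝓡 m) 𝓘(ℝ, E) n fun y : Metric.sphere (0 : F) 1 => e.symm y :=
      e.symm.contDiff.contMDiff.comp contMDiff_coe_sphere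
    exact h.codRestrict_sphere _

end InnerProductSpace

section SubmanifoldQuotient

variable {E F H K K' N : Type*} [NormedAddCommGroup E] [NormedSpace ℝ E]
  [NormedAddCommGroup F] [NormedSpace ℝ F] [NormedAddCommGroup H] [NormedSpace ℝ H]
  [NormedAddCommGroup K] [NormedSpace ℝ K] [TopologicalSpace K'] {J : ModelWithCorners ℝ K K'}
  [TopologicalSpace N] [ChartedSpace K' N]

theorem submanifold_contMDiff_of_coe (S : Set E)
    (h : ∀ x : S, ∃ e ∈ submanifoldAtlas S H, x ∈ e.source)
    {σ : N → S} (hσ : ContMDiff J 𝓘(ℝ, E) ∞ fun x => (σ x : E)) :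
    letI := submanifoldChartedSpace S h
    ContMDiff J 𝓘(ℝ, H) ∞ σ := by
  let _ := submanifoldChartedSpace S h
  have := submanifold_isManifold S h
  intro x
  set e := chartAt H (σ x)
  have hx : σ x ∈ e.source := mem_chart_source H _
  obtain ⟨U, f, hU, hxU, hf, hef⟩ := (h (σ x)).choose_spec.1.2 (σ x) hx
  have hfσ : ContMDiffAt J 𝓘(ℝ, H) ∞ (fun y => f (σ y)) x :=
    ((hf _ hxU).contDiffAt (hU.mem_nhds hxU)).contMDiffAt.comp x (hσ x)
  have hsymm : ContMDiffAt 𝓘(ℝ, H) 𝓘(ℝ, H) ∞ e.symm (f (σ x)) :=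
    hef (σ x) hx hxU ▸ contMDiffAt_symm_of_mem_maximalAtlas
      (IsManifold.chart_mem_maximalAtlas _) (e.map_source hx)
  refine (hsymm.comp x hfσ).congr_of_eventuallyEq ?_
  have hcont : ContinuousAt σ x :=
    Topology.IsInducing.subtypeVal.continuousAt_iff.2 (hσ x).continuousAt
  filter_upwards [hcont.eventually (e.open_source.mem_nhds hx),
    (hσ x).continuousAt.eventually (hU.mem_nhds hxU)] with y hy hyU
  exact (e.left_inv hy).symm.trans (congrArg e.symm (hef _ hy hyU))

variable {P X : Type*} [TopologicalSpace P] [ChartedSpace F P] [TopologicalSpace X]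

theorem quotient_contMDiff_proj (π : P → X) (hπ : Continuous π)
    (h : ∀ x : X, ∃ e ∈ quotientAtlas F H π, x ∈ e.source) :
    letI := quotientChartedSpace π h
    ContMDiff 𝓘(ℝ, F) 𝓘(ℝ, H) ∞ π := by
  let _ := quotientChartedSpace π h
  have := quotient_isManifold π hπ h
  intro p
  set e := chartAt H (π p)
  have hp : π p ∈ e.source := mem_chart_source H _
  have hnhds : π ⁻¹' e.source ∈ 𝓝 p := (e.open_source.preimage hπ).mem_nhds hp
  have hsymm : ContMDiffAt 𝓘(ℝ, H) 𝓘(ℝ, H) ∞ e.symm (e (π p)) :=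
    contMDiffAt_symm_of_mem_maximalAtlas (IsManifold.chart_mem_maximalAtlas _) (e.map_source hp)
  have he : ContMDiffAt 𝓘(ℝ, F) 𝓘(ℝ, H) ∞ (fun q => e (π q)) p :=
    ((h (π p)).choose_spec.1.1 p hp).contMDiffAt hnhds
  refine (hsymm.comp p he).congr_of_eventuallyEq ?_
  filter_upwards [hnhds] with q hq
  exact (e.left_inv hq).symm

theorem quotient_contMDiff_of_comp (π : P → X) (hπ : Continuous π)
    (h : ∀ x : X, ∃ e ∈ quotientAtlas F H π, x ∈ e.source) {g : X → N}
    (hg : ContMDiff 𝓘(ℝ, F) J ∞ (g ∘ π)) :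
    letI := quotientChartedSpace π h
    ContMDiff 𝓘(ℝ, H) J ∞ g := by
  let _ := quotientChartedSpace π h
  have := quotient_isManifold π hπ h
  intro x
  set e := chartAt H x
  have hx : x ∈ e.source := mem_chart_source H x
  obtain ⟨U, σ, hU, hxU, -, hσ, hσe⟩ := (h x).choose_spec.1.2 _ (e.map_source hx)
  have he : ContMDiffAt 𝓘(ℝ, H) 𝓘(ℝ, H) ∞ e x :=
    contMDiffAt_of_mem_maximalAtlas (IsManifold.chart_mem_maximalAtlas x) hx
  have hgσ : ContMDiffAt 𝓘(ℝ, H) J ∞ (g ∘ π ∘ σ) (e x) :=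
    (hg _).comp _ ((hσ _ hxU).contMDiffAt (hU.mem_nhds hxU))
  refine (hgσ.comp x he).congr_of_eventuallyEq ?_
  filter_upwards [e.open_source.mem_nhds hx, he.continuousAt.eventually (hU.mem_nhds hxU)]
    with z hz hzU
  exact congrArg g ((hσe _ hzU).trans (e.left_inv hz)).symm

end SubmanifoldQuotient

section PowerSeries

open PowerSeries

/-- The power series with conjugated coefficients, which is the expansion of `f^c` if the original
series is the expansion of `f`. -/
def conjSeries {R : Type*} [Semiring R] [StarRing R] (φ : R⟦X⟧) : R⟦X⟧ :=
  mk fun n => star (coeff n φ)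

section Semiring

variable {R : Type*} [Semiring R] [StarRing R]

theorem coeff_conjSeries (φ : R⟦X⟧) (n : ℕ) : coeff n (conjSeries φ) = star (coeff n φ) :=
  coeff_mk _ _

theorem conjSeries_conjSeries (φ : R⟦X⟧) : conjSeries (conjSeries φ) = φ :=
  PowerSeries.ext fun n => by rw [coeff_conjSeries, coeff_conjSeries, star_star]

theorem conjSeries_mul (φ ψ : R⟦X⟧) : conjSeries (φ * ψ) = conjSeries ψ * conjSeries φ :=
  PowerSeries.ext fun n => by
    simp only [coeff_conjSeries, coeff_mul, star_sum, star_mul]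
    exact Finset.Nat.sum_antidiagonal_swap (f := fun k : ℕ × ℕ =>
      star (coeff k.1 ψ) * star (coeff k.2 φ))

theorem conjSeries_one : conjSeries (1 : R⟦X⟧) = 1 :=
  PowerSeries.ext fun n => by
    rw [coeff_conjSeries, coeff_one, apply_ite star, star_one, star_zero]

end Semiring

theorem one_sub_C_mul_X_mul_mk_pow {R : Type*} [Ring R] (p : R) :
    (1 - C p * X) * mk (p ^ ·) = 1 := by
  ext n
  rw [sub_mul, one_mul, map_sub, mul_assoc, coeff_C_mul, coeff_mk]
  cases n with
  | zero => simp
  | succ n => simp [coeff_succ_X_mul, pow_succ', coeff_one]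

theorem coeff_one_mk_pow_mul_linear {R : Type*} [Semiring R] (p x y : R) :
    coeff 1 (mk (p ^ ·) * (C x * X + C y)) = x + p * y := by
  rw [mul_add, map_add, ← mul_assoc, coeff_succ_mul_X, coeff_mul_C, coeff_mul_C, coeff_mk,
    coeff_mk, pow_zero, pow_one, one_mul]

theorem commute_coeff_of_conjSeries_eq {φ : ℍ[ℝ]⟦X⟧} (hφ : conjSeries φ = φ) (n : ℕ)
    (q : ℍ[ℝ]) : Commute (coeff n φ) q := by
  have hreal : star (coeff n φ) = coeff n φ := by rw [← coeff_conjSeries, hφ]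
  rw [Quaternion.star_eq_self.1 hreal]
  exact Quaternion.coe_commute _ q

theorem commute_of_conjSeries_eq {φ : ℍ[ℝ]⟦X⟧} (hφ : conjSeries φ = φ) (ψ : ℍ[ℝ]⟦X⟧) :
    Commute φ ψ :=
  PowerSeries.ext fun n => by
    rw [coeff_mul, coeff_mul, ← Finset.Nat.sum_antidiagonal_swap]
    exact Finset.sum_congr rfl fun k _ => commute_coeff_of_conjSeries_eq hφ _ _

/-- `f` is slice regular with power series expansion `f q = ∑ qⁿ φₙ`. Encoding the coefficients in
`ℍ⟦X⟧`, where `X` is central, turns the regular product into the product of power series. -/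
def HasRegularSeries (f : unitBall → ℍ[ℝ]) (φ : ℍ[ℝ]⟦X⟧) : Prop :=
  HasRegularExpansion f fun n => coeff n φ

theorem norm_coe_unitBall_lt_one (q : unitBall) : ‖(q : ℍ[ℝ])‖ < 1 :=
  mem_ball_zero_iff.1 q.2

namespace HasRegularSeries

variable {f g : unitBall → ℍ[ℝ]} {φ ψ : ℍ[ℝ]⟦X⟧}

theorem unique (hf : HasRegularSeries f φ) (hf' : HasRegularSeries f ψ) : φ = ψ :=
  PowerSeries.ext (congrFun (HasRegularExpansion.unique hf hf'))

theorem fun_unique (hf : HasRegularSeries f φ) (hg : HasRegularSeries g φ) : f = g :=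
  funext fun q => (hf q).unique (hg q)

theorem summable_norm (hf : HasRegularSeries f φ) (q : unitBall) :
    Summable fun n => ‖(q : ℍ[ℝ]) ^ n * coeff n φ‖ := by
  obtain ⟨r, hqr, hr⟩ := exists_between (norm_coe_unitBall_lt_one q)
  have hr0 : 0 < r := (norm_nonneg _).trans_lt hqr
  have hrnorm : ‖(r : ℍ[ℝ])‖ = r := by rw [Quaternion.norm_coe, Real.norm_of_nonneg hr0.le]
  obtain ⟨K, hK⟩ := (hf ⟨r, mem_ball_zero_iff.2 (hrnorm.trans_lt hr)⟩).summable.tendsto_atTop_zero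
    |>.norm.bddAbove_range
  have hratio : Summable fun n => (‖(q : ℍ[ℝ])‖ / r) ^ n * K :=
    (summable_geometric_of_lt_one (by positivity) ((div_lt_one hr0).2 hqr)).mul_right K
  refine hratio.of_nonneg_of_le (fun _ => norm_nonneg _) fun n => ?_
  have hn : r ^ n * ‖coeff n φ‖ ≤ K := by
    simpa only [norm_mul, norm_pow, hrnorm] using hK (mem_range_self n)
  calc ‖(q : ℍ[ℝ]) ^ n * coeff n φ‖ = (‖(q : ℍ[ℝ])‖ / r) ^ n * (r ^ n * ‖coeff n φ‖) := by
        rw [norm_mul, norm_pow, ← mul_assoc, ← mul_pow, div_mul_cancel₀ _ hr0.ne']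
    _ ≤ (‖(q : ℍ[ℝ])‖ / r) ^ n * K := by gcongr

theorem summable_mul (hf : HasRegularSeries f φ) (hg : HasRegularSeries g ψ) (q : unitBall) :
    Summable fun n => (q : ℍ[ℝ]) ^ n * coeff n (φ * ψ) := by
  refine Summable.of_norm_bounded (summable_norm_sum_mul_antidiagonal_of_summable_norm
    (hf.summable_norm q).norm (hg.summable_norm q).norm).of_norm fun n => ?_
  simp only [coeff_mul, Finset.mul_sum]
  refine norm_sum_le_of_le _ fun k hk => ?_
  rw [← Finset.HasAntidiagonal.mem_antidiagonal.1 hk]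
  simp only [norm_mul, norm_pow, pow_add]
  exact le_of_eq (by ring)

theorem starMul (hf : HasRegularSeries f φ) (hg : HasRegularSeries g ψ) :
    HasRegularSeries (starMul f g) (φ * ψ) := by
  intro q
  convert (hf.summable_mul hg q).hasSum using 1
  simp only [_root_.starMul, HasRegularExpansion.regularCoeff_eq hf,
    HasRegularExpansion.regularCoeff_eq hg, coeff_mul,
    Finset.Nat.sum_antidiagonal_eq_sum_range_succ fun i j => coeff i φ * coeff j ψ]

theorem regularConj (hf : HasRegularSeries f φ) :
    HasRegularSeries (regularConj f) (conjSeries φ) := by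
  intro q
  have hsum : Summable fun n => (q : ℍ[ℝ]) ^ n * coeff n (conjSeries φ) :=
    .of_norm <| by simpa only [coeff_conjSeries, norm_mul, norm_star] using hf.summable_norm q
  simpa only [_root_.regularConj, HasRegularExpansion.regularCoeff_eq hf, coeff_conjSeries]
    using hsum.hasSum

theorem starMul_apply (hf : HasRegularSeries f φ) (hg : HasRegularSeries g ψ)
    (hφ : conjSeries φ = φ) (q : unitBall) : _root_.starMul f g q = f q * g q := by
  refine (hf.starMul hg q).unique ?_
  have h := tsum_mul_tsum_eq_tsum_sum_antidiagonal_of_summable_norm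
    (hf.summable_norm q) (hg.summable_norm q)
  rw [← (hf q).tsum_eq, ← (hg q).tsum_eq, h]
  convert (hf.summable_mul hg q).hasSum using 1
  refine tsum_congr fun n => ?_
  rw [coeff_mul, Finset.mul_sum]
  refine Finset.sum_congr rfl fun k hk => ?_
  rw [← Finset.HasAntidiagonal.mem_antidiagonal.1 hk, pow_add, mul_assoc, mul_assoc,
    ← mul_assoc (coeff _ φ), (commute_coeff_of_conjSeries_eq hφ _ _).eq, mul_assoc]

end HasRegularSeries

theorem hasRegularSeries_linear (a b : ℍ[ℝ]) :
    HasRegularSeries (fun q => q * a + b) (C a * X + C b) := by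
  intro q
  have h : HasSum (fun n => (q : ℍ[ℝ]) ^ n * coeff n (C a * X + C b))
      (∑ n ∈ Finset.range 2, (q : ℍ[ℝ]) ^ n * coeff n (C a * X + C b)) :=
    hasSum_sum_of_ne_finset_zero fun n hn => by
      obtain ⟨m, rfl⟩ := Nat.exists_eq_add_of_le (not_lt.1 (mt Finset.mem_range.2 hn))
      simp [add_comm 2]
  simpa [Finset.sum_range_succ, coeff_C, add_comm] using h

theorem hasRegularSeries_tsum_pow {p : ℍ[ℝ]} (hp : ‖p‖ < 1) (c : ℍ[ℝ]) :
    HasRegularSeries (fun q => (∑' n : ℕ, (q : ℍ[ℝ]) ^ n * p ^ n) * c) (mk (p ^ ·) * C c) := by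
  intro q
  have hqp : ‖(q : ℍ[ℝ])‖ * ‖p‖ < 1 :=
    mul_lt_one_of_nonneg_of_lt_one_right (norm_coe_unitBall_lt_one q).le (norm_nonneg _) hp
  have hsum : Summable fun n => (q : ℍ[ℝ]) ^ n * p ^ n :=
    .of_norm <| by
      simpa only [norm_mul, norm_pow, ← mul_pow] using
        summable_geometric_of_lt_one (by positivity) hqp
  simpa only [coeff_mul_C, coeff_mk, mul_assoc] using hsum.hasSum.mul_right c

/-- With `S = f^s`, whose coefficients are real and hence central, one has `S ψ = f^c` and
`S (ψᶜ ψ) = 1`, so that `f^s` has no zeros. -/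
theorem starInv_eq_of_mul_eq_one {f g : unitBall → ℍ[ℝ]} {φ ψ : ℍ[ℝ]⟦X⟧}
    (hf : HasRegularSeries f φ) (hg : HasRegularSeries g ψ) (h : φ * ψ = 1) :
    starInv f = g := by
  set S := φ * conjSeries φ
  have hS : HasRegularSeries (symmetrization f) S := hf.starMul hf.regularConj
  have hSconj : conjSeries S = S := by rw [conjSeries_mul, conjSeries_conjSeries]
  have hconj : conjSeries φ * conjSeries ψ = 1 := by
    rw [← conjSeries_mul, mul_eq_one_comm.1 h, conjSeries_one]
  have hSψ : S * ψ = conjSeries φ := by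
    rw [(commute_of_conjSeries_eq hSconj ψ).eq, ← mul_assoc, mul_eq_one_comm.1 h, one_mul]
  have hSinv : S * (conjSeries ψ * ψ) = 1 := by
    rw [← mul_assoc, mul_assoc φ, hconj, mul_one, h]
  have hone : HasRegularSeries (fun _ => 1) 1 := by
    simpa using hasRegularSeries_linear 0 1
  have hSg : starMul (symmetrization f) g = regularConj f :=
    (hSψ ▸ hS.starMul hg).fun_unique hf.regularConj
  have hgg := hg.regularConj.starMul hg
  have hSgg : starMul (symmetrization f) (starMul (regularConj g) g) = fun _ => 1 :=
    (hSinv ▸ hS.starMul hgg).fun_unique hone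
  funext q
  have hne : symmetrization f q ≠ 0 :=
    left_ne_zero_of_mul_eq_one <| (hS.starMul_apply hgg hSconj q).symm.trans (congrFun hSgg q)
  rw [starInv, ← hSg, hS.starMul_apply hg hSconj, inv_mul_cancel_left₀ hne]

theorem hasRegularSeries_starMul_starInv {p d : ℍ[ℝ]} (hp : ‖p‖ < 1) (hd : d ≠ 0)
    {h : unitBall → ℍ[ℝ]} {χ : ℍ[ℝ]⟦X⟧} (hh : HasRegularSeries h (C d * χ)) :
    HasRegularSeries (starMul (starInv fun q => d - q * (d * p)) h) (mk (p ^ ·) * χ) := by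
  have hlin : HasRegularSeries (fun q => d - q * (d * p)) (C d * (1 - C p * X)) := by
    convert hasRegularSeries_linear (-(d * p)) d using 1
    · exact funext fun q => by rw [mul_neg, neg_add_eq_sub]
    · rw [mul_sub, mul_one, ← mul_assoc, ← map_mul, map_neg, neg_mul, neg_add_eq_sub]
  have hgeom := hasRegularSeries_tsum_pow hp d⁻¹
  have hCd : (C d⁻¹ * C d : ℍ[ℝ]⟦X⟧) = 1 := by rw [← map_mul, inv_mul_cancel₀ hd, map_one]
  have hinv : C d * (1 - C p * X) * (mk (p ^ ·) * C d⁻¹) = 1 := by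
    rw [mul_assoc, ← mul_assoc (1 - _), one_sub_C_mul_X_mul_mk_pow, one_mul, mul_eq_one_comm.1 hCd]
  rw [starInv_eq_of_mul_eq_one hlin hgeom hinv]
  convert hgeom.starMul hh using 1
  rw [mul_assoc, ← mul_assoc (C d⁻¹), hCd, one_mul]

theorem hasRegularSeries_mobiusParam {a : ℍ[ℝ]} (ha : ‖a‖ < 1) (u : ℍ[ℝ]) :
    HasRegularSeries (mobiusParam a u) (mk (star a ^ ·) * (C u * X + C (-(a * u)))) := by
  have hnum : HasRegularSeries (fun q => (q - a) * u) (C 1 * (C u * X + C (-(a * u)))) := by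
    convert hasRegularSeries_linear u (-(a * u)) using 1
    · exact funext fun q => by rw [sub_mul, sub_eq_add_neg]
    · rw [map_one, one_mul]
  simpa only [one_mul, mobiusParam] using
    hasRegularSeries_starMul_starInv ((norm_star a).trans_lt ha) one_ne_zero hnum

theorem regularMobius_eq_mobiusParam {p d : ℍ[ℝ]} (hp : ‖p‖ < 1) (hd : d ≠ 0) (u : ℍ[ℝ]) :
    regularMobius !![d * u, -(d * star p); -(d * (p * u)), d] = mobiusParam p u := by
  have hden : regularLinear (-(d * star p)) d = fun q : unitBall => d - q * (d * star p) :=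
    funext fun q => by rw [regularLinear, mul_neg, neg_add_eq_sub]
  have hnum : HasRegularSeries (regularLinear (d * u) (-(d * (p * u))))
      (C d * (C u * X + C (-(p * u)))) := by
    convert hasRegularSeries_linear (d * u) (-(d * (p * u))) using 1
    · rfl
    · rw [mul_add, ← mul_assoc, ← map_mul, ← map_mul, mul_neg]
  change starMul (starInv (regularLinear (-(d * star p)) d)) (regularLinear _ _) = _
  rw [hden]
  exact (hasRegularSeries_starMul_starInv ((norm_star p).trans_lt hp) hd hnum).fun_unique
    (hasRegularSeries_mobiusParam hp u)

theorem mobiusParam_injective {a b : ℍ[ℝ]} (ha : ‖a‖ < 1) (hb : ‖b‖ < 1) {u v : ℍ[ℝ]}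
    (hu : ‖u‖ = 1) (hv : ‖v‖ = 1) (h : mobiusParam a u = mobiusParam b v) : a = b ∧ u = v := by
  have hseries : mk (star a ^ ·) * (C u * X + C (-(a * u))) =
      mk (star b ^ ·) * (C v * X + C (-(b * v))) :=
    (hasRegularSeries_mobiusParam ha u).unique (by rw [h]; exact hasRegularSeries_mobiusParam hb v)
  have h0 : a * u = b * v := by simpa using congrArg constantCoeff hseries
  have h1 : u + star a * -(a * u) = v + star b * -(b * v) := by
    rw [← coeff_one_mk_pow_mul_linear, hseries, coeff_one_mk_pow_mul_linear]
  have hfactor : ∀ x w : ℍ[ℝ], w + star x * -(x * w) = (1 - ‖x‖ ^ 2) • w := fun x w => by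
    rw [mul_neg, ← mul_assoc, Quaternion.star_mul_self, Quaternion.normSq_eq_norm_mul_self,
      Quaternion.coe_mul_eq_smul, sub_smul, one_smul, sq, sub_eq_add_neg]
  have hnorm : ‖a‖ = ‖b‖ := by simpa only [norm_mul, hu, hv, mul_one] using congrArg norm h0
  have hb' : 1 - ‖b‖ ^ 2 ≠ 0 := (sub_pos.2 (pow_lt_one₀ (norm_nonneg b) hb two_ne_zero)).ne'
  rw [hfactor, hfactor, hnorm] at h1
  have huv : u = v := smul_right_injective _ hb' h1
  have hv0 : v ≠ 0 := norm_ne_zero_iff.1 (hv ▸ one_ne_zero)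
  exact ⟨mul_right_cancel₀ hv0 (huv ▸ h0), huv⟩

end PowerSeries

section BallCoordinates

/-- The matrix in `GL₂(ℍ)` whose multiple by a positive scalar is the representative in `Sp(1,1)` of
the coset with coordinates `(p, u)`. -/
def ballMatrix (p u : ℍ[ℝ]) : Matrix (Fin 2) (Fin 2) ℍ[ℝ] :=
  !![star u, star u * star p; p, 1]

theorem ballMatrix_conjTranspose_mul_signatureMatrix_mul (p : ℍ[ℝ]) {u : ℍ[ℝ]} (hu : ‖u‖ = 1) :
    (ballMatrix p u)ᴴ * signatureMatrix * ballMatrix p u = (1 - ‖p‖ ^ 2) • signatureMatrix := by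
  have huu : u * star u = 1 := by
    rw [Quaternion.self_mul_star, Quaternion.normSq_eq_norm_mul_self, hu, one_mul,
      Quaternion.coe_one]
  have hpp : (1 - ‖p‖ ^ 2) • (1 : ℍ[ℝ]) = 1 - star p * p := by
    rw [Quaternion.star_mul_self, Quaternion.normSq_eq_norm_mul_self, sub_smul, one_smul, ← sq,
      ← Quaternion.coe_mul_eq_smul, mul_one]
  have huu' : ∀ q, u * (star u * q) = q := fun q => by rw [← mul_assoc, huu, one_mul]
  have hnormal : p * star p = star p * p := by
    rw [Quaternion.self_mul_star, Quaternion.star_mul_self]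
  ext1 i j
  fin_cases i <;> fin_cases j <;>
    simp [ballMatrix, signatureMatrix, Matrix.mul_apply, Fin.sum_univ_two, mul_assoc, huu, huu',
      hpp, hnormal, ← sub_eq_add_neg]

theorem smul_eq_mul_diagonal_coe (t : ℝ) (M : Matrix (Fin 2) (Fin 2) ℍ[ℝ]) :
    t • M = M * Matrix.diagonal fun _ => (t : ℍ[ℝ]) :=
  Matrix.ext fun i j => by
    rw [Matrix.mul_diagonal, Quaternion.mul_coe_eq_smul, Matrix.smul_apply]

theorem one_sub_norm_sq_pos (q : unitBall) : 0 < 1 - ‖(q : ℍ[ℝ])‖ ^ 2 :=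
  sub_pos.2 (pow_lt_one₀ (norm_nonneg _) (norm_coe_unitBall_lt_one q) two_ne_zero)

namespace SpOneOne

theorem norm_lower_right_sq (A : SpOneOne) : ‖A.1 1 1‖ ^ 2 = 1 + ‖A.1 0 1‖ ^ 2 := by
  simpa only [Quaternion.normSq_eq_norm_mul_self, ← sq] using (SpOneOne.rel A.2).1

theorem norm_upper_left (A : SpOneOne) : ‖A.1 0 0‖ = ‖A.1 1 1‖ := by
  obtain ⟨hd, ha, -⟩ := SpOneOne.rel A.2
  rw [← sq_eq_sq₀ (norm_nonneg _) (norm_nonneg _)]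
  simpa only [Quaternion.normSq_eq_norm_mul_self, ← sq] using ha.trans hd.symm

theorem norm_upper_right_lt (A : SpOneOne) : ‖A.1 0 1‖ < ‖A.1 1 1‖ :=
  lt_of_pow_lt_pow_left₀ 2 (norm_nonneg _) (norm_lower_right_sq A ▸ lt_one_add _)

theorem lower_right_ne_zero (A : SpOneOne) : A.1 1 1 ≠ 0 :=
  norm_pos_iff.1 ((norm_nonneg _).trans_lt (norm_upper_right_lt A))

theorem norm_lower_left (A : SpOneOne) : ‖A.1 1 0‖ = ‖A.1 0 1‖ := by
  have h := congrArg norm (SpOneOne.rel A.2).2.2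
  rw [norm_mul, norm_mul, norm_star, norm_star, norm_upper_left, mul_comm ‖A.1 0 1‖] at h
  exact mul_left_cancel₀ (norm_ne_zero_iff.2 (lower_right_ne_zero A)) h

/-- The coordinates of `A Sp(1) I₂` in `𝔹 × Sp(1)`. For a matrix with rows `(a, c)` and `(b, d)`
these are `b d⁻¹` and the conjugate of `a d⁻¹`. -/
def ballCoord (A : SpOneOne) : unitBall × Metric.sphere (0 : ℍ[ℝ]) 1 :=
  (⟨A.1 1 0 * (A.1 1 1)⁻¹, mem_ball_zero_iff.2 <| by
      rw [norm_mul, norm_inv, ← div_eq_mul_inv, norm_lower_left,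
        div_lt_one (norm_pos_iff.2 (lower_right_ne_zero A))]
      exact norm_upper_right_lt A⟩,
    ⟨star (A.1 0 0 * (A.1 1 1)⁻¹), mem_sphere_zero_iff_norm.2 <| by
      rw [norm_star, norm_mul, norm_inv, norm_upper_left,
        mul_inv_cancel₀ (norm_ne_zero_iff.2 (lower_right_ne_zero A))]⟩)

theorem coe_eq_ballMatrix_mul_diagonal (A : SpOneOne) :
    A.1 = ballMatrix (ballCoord A).1 (ballCoord A).2 * Matrix.diagonal fun _ => A.1 1 1 := by
  have hd := lower_right_ne_zero A
  have hunit : A.1 0 0 * (A.1 1 1)⁻¹ * star (A.1 0 0 * (A.1 1 1)⁻¹) = 1 := by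
    rw [Quaternion.self_mul_star, Quaternion.normSq_eq_norm_mul_self, norm_mul, norm_inv,
      norm_upper_left, mul_inv_cancel₀ (norm_ne_zero_iff.2 hd), one_mul, Quaternion.coe_one]
  have hupper : A.1 0 0 * (A.1 1 1)⁻¹ * star (A.1 1 0 * (A.1 1 1)⁻¹) * A.1 1 1 = A.1 0 1 := by
    have hrel : star (A.1 1 0) * A.1 1 1 = star (A.1 0 0) * A.1 0 1 := by
      simpa only [star_mul, star_star] using congrArg star (SpOneOne.rel A.2).2.2
    rw [star_mul, mul_assoc, mul_assoc _ (star _), hrel, ← mul_assoc (star _), ← star_mul,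
      ← mul_assoc, hunit, one_mul]
  refine Matrix.ext fun i j => ?_
  rw [Matrix.mul_diagonal]
  fin_cases i <;> fin_cases j
  · exact (by simp [ballMatrix, ballCoord, hd])
  · exact (by simpa [ballMatrix, ballCoord] using hupper.symm)
  · exact (by simp [ballMatrix, ballCoord, hd])
  · exact (one_mul _).symm

theorem apply_eq_ballMatrix_apply_mul (A : SpOneOne) (i j : Fin 2) :
    A.1 i j = ballMatrix (ballCoord A).1 (ballCoord A).2 i j * A.1 1 1 := by
  conv_lhs => rw [coe_eq_ballMatrix_mul_diagonal, Matrix.mul_diagonal]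

theorem ballCoord_eq {A : SpOneOne} {x : unitBall × Metric.sphere (0 : ℍ[ℝ]) 1} {w : ℍ[ℝ]}
    (hA : A.1 = ballMatrix x.1 x.2 * Matrix.diagonal fun _ => w) : ballCoord A = x := by
  have hentry : ∀ i j, A.1 i j = ballMatrix x.1 x.2 i j * w := fun i j => by
    rw [hA, Matrix.mul_diagonal]
  have hd : A.1 1 1 = w := (hentry 1 1).trans (one_mul w)
  have hw : w ≠ 0 := hd ▸ (lower_right_ne_zero A)
  refine Prod.ext (Subtype.ext ?_) (Subtype.ext ?_)
  · change A.1 1 0 * (A.1 1 1)⁻¹ = x.1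
    rw [hd, hentry, mul_inv_cancel_right₀ hw]
    rfl
  · change star (A.1 0 0 * (A.1 1 1)⁻¹) = x.2
    rw [hd, hentry, mul_inv_cancel_right₀ hw]
    exact star_star _

theorem ballCoord_eq_of_proj_eq {A B : SpOneOne} (h : proj A = proj B) :
    ballCoord A = ballCoord B := by
  obtain ⟨u, -, hB⟩ := proj_rel h
  refine (ballCoord_eq (w := A.1 1 1 * u) (Matrix.ext fun i j => ?_)).symm
  rw [hB, Matrix.mul_diagonal, ← mul_assoc, ← apply_eq_ballMatrix_apply_mul]

/-- A smooth section of the projection `Sp(1,1) → Sp(1,1) / Sp(1) I₂` in terms of `ballCoord`. -/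
def ballSection (x : unitBall × Metric.sphere (0 : ℍ[ℝ]) 1) : SpOneOne :=
  ⟨(√(1 - ‖(x.1 : ℍ[ℝ])‖ ^ 2))⁻¹ • ballMatrix x.1 x.2, by
    have hpos := one_sub_norm_sq_pos x.1
    have : StarModule ℝ ℍ[ℝ] := ⟨fun t q => by rw [Quaternion.star_smul, star_trivial t]⟩
    change _ * _ * _ = _
    rw [Matrix.conjTranspose_smul, smul_mul_assoc, smul_mul_smul_comm, star_trivial (√_)⁻¹,
      ← _root_.mul_inv, Real.mul_self_sqrt hpos.le,
      ballMatrix_conjTranspose_mul_signatureMatrix_mul _ (norm_eq_of_mem_sphere x.2),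
      inv_smul_smul₀ hpos.ne']⟩

theorem coe_ballSection (x : unitBall × Metric.sphere (0 : ℍ[ℝ]) 1) :
    (ballSection x).1 = (√(1 - ‖(x.1 : ℍ[ℝ])‖ ^ 2))⁻¹ • ballMatrix x.1 x.2 :=
  rfl

theorem ballCoord_ballSection (x : unitBall × Metric.sphere (0 : ℍ[ℝ]) 1) :
    ballCoord (ballSection x) = x :=
  ballCoord_eq (smul_eq_mul_diagonal_coe _ _)

theorem inv_mul_mem_spOneScalar {A B : SpOneOne} {w : ℍ[ℝ]}
    (h : A.1 = B.1 * Matrix.diagonal fun _ => w) : B⁻¹ * A ∈ spOneScalar := by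
  have hcoe : (B⁻¹ * A).1 = Matrix.diagonal fun _ => w := by
    rw [coe_mul, h, ← mul_assoc, ← coe_mul, inv_mul_cancel, coe_one, one_mul]
  have hw := norm_lower_right_sq (B⁻¹ * A)
  rw [hcoe, Matrix.diagonal_apply_eq, Matrix.diagonal_apply_ne _ zero_ne_one, norm_zero] at hw
  exact ⟨w, (sq_eq_sq₀ (norm_nonneg w) zero_le_one).1 (by simpa using hw), hcoe⟩

theorem ballSection_ballCoord_inv_mul_mem (A : SpOneOne) :
    (ballSection (ballCoord A))⁻¹ * A ∈ spOneScalar := by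
  have ht : √(1 - ‖((ballCoord A).1 : ℍ[ℝ])‖ ^ 2) ≠ 0 :=
    Real.sqrt_ne_zero'.2 (one_sub_norm_sq_pos _)
  refine inv_mul_mem_spOneScalar (w := (√(1 - ‖((ballCoord A).1 : ℍ[ℝ])‖ ^ 2)) • A.1 1 1) ?_
  refine (coe_eq_ballMatrix_mul_diagonal A).trans (Matrix.ext fun i j => ?_)
  rw [coe_ballSection, Matrix.mul_diagonal, Matrix.mul_diagonal, Matrix.smul_apply,
    smul_mul_smul_comm, inv_mul_cancel₀ ht, one_smul]

theorem contMDiff_mul_right (k : SpOneOne) : ContMDiff (𝓡 10) (𝓡 10) ∞ (· * k) :=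
  submanifold_contMDiff_of_coe SpOneOne exists_chart
    ((LinearMap.mulRight ℝ k.1).toContinuousLinearMap.contDiff.contMDiff.comp
      (submanifold_contMDiff_coe SpOneOne exists_chart))

theorem contMDiff_ballSection :
    ContMDiff (𝓘(ℝ, ℍ[ℝ]).prod (𝓡 3)) (𝓡 10) ∞ ballSection := by
  refine submanifold_contMDiff_of_coe SpOneOne exists_chart fun x => ?_
  have hp : ContMDiffAt (𝓘(ℝ, ℍ[ℝ]).prod (𝓡 3)) 𝓘(ℝ, ℍ[ℝ]) ∞
      (fun x : unitBall × Metric.sphere (0 : ℍ[ℝ]) 1 => (x.1 : ℍ[ℝ])) x :=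
    (contMDiff_subtype_val.comp contMDiff_fst) x
  have hu : ContMDiffAt (𝓘(ℝ, ℍ[ℝ]).prod (𝓡 3)) 𝓘(ℝ, ℍ[ℝ]) ∞
      (fun x : unitBall × Metric.sphere (0 : ℍ[ℝ]) 1 => (x.2 : ℍ[ℝ])) x :=
    (contMDiff_coe_sphere.comp contMDiff_snd) x
  have hscalar : ContDiffAt ℝ ∞ (fun q : ℍ[ℝ] => (√(1 - ‖q‖ ^ 2))⁻¹) x.1 :=
    ((contDiff_const.sub (contDiff_norm_sq ℝ)).contDiffAt.sqrt (one_sub_norm_sq_pos x.1).ne').inv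
      (Real.sqrt_ne_zero'.2 (one_sub_norm_sq_pos x.1))
  have hmatrix : ContDiff ℝ ∞ fun y : ℍ[ℝ] × ℍ[ℝ] => ballMatrix y.1 y.2 :=
    contDiff_matrix fun i j => by
      fin_cases i <;> fin_cases j
      · exact contDiff_quaternion_star.comp contDiff_snd
      · exact (contDiff_quaternion_star.comp contDiff_snd).mul
          (contDiff_quaternion_star.comp contDiff_fst)
      · exact contDiff_fst
      · exact contDiff_const
  exact (hscalar.contMDiffAt.comp x hp).smul
    (hmatrix.contMDiff.contMDiffAt.comp x (hp.prodMk_space hu))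

theorem contMDiff_ballCoord :
    ContMDiff (𝓡 10) (𝓘(ℝ, ℍ[ℝ]).prod (𝓡 3)) ∞ ballCoord := by
  have hquot : ∀ i j : Fin 2, ContMDiff (𝓡 10) 𝓘(ℝ, ℍ[ℝ]) ∞
      fun A : SpOneOne => A.1 i j * (A.1 1 1)⁻¹ := fun i j A => by
    have hinv : ContDiffAt ℝ ∞ (fun q : ℍ[ℝ] => q⁻¹) (A.1 1 1) := by
      simpa only [Ring.inverse_eq_inv', Units.val_mk0] using
        contDiffAt_ringInverse ℝ (Units.mk0 _ (lower_right_ne_zero A))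
    exact ((contDiff_entry i j).contDiffAt.mul
      (hinv.comp A.1 (contDiff_entry 1 1).contDiffAt)).contMDiffAt.comp A
      (submanifold_contMDiff_coe SpOneOne exists_chart A)
  refine ContMDiff.prodMk ((ContMDiff.subtypeVal_comp_iff _ _).1 (hquot 1 0)) ?_
  have h : ContMDiff (𝓡 10) 𝓘(ℝ, ℍ[ℝ]) ∞
      fun A : SpOneOne => star (A.1 0 0 * (A.1 1 1)⁻¹) :=
    contDiff_quaternion_star.contMDiff.comp (hquot 0 0)
  exact h.codRestrict_sphere _

theorem contMDiff_proj : ContMDiff (𝓡 10) (𝓡 7) ∞ proj :=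
  quotient_contMDiff_proj proj continuous_quotient_mk' exists_qchart

/-- The coordinates `ballCoord` as a diffeomorphism from `Sp(1,1) / Sp(1) I₂` onto `𝔹 × Sp(1)`. -/
def ballDiffeomorph : (SpOneOne ⧸ spOneScalar) ≃ₘ⟮𝓡 7, 𝓘(ℝ, ℍ[ℝ]).prod (𝓡 3)⟯
    (unitBall × Metric.sphere (0 : ℍ[ℝ]) 1) where
  toFun := Quotient.lift ballCoord fun _ _ h => ballCoord_eq_of_proj_eq (Quotient.sound h)
  invFun x := proj (ballSection x)
  left_inv := by
    rintro ⟨A⟩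
    exact QuotientGroup.eq.2 (ballSection_ballCoord_inv_mul_mem A)
  right_inv := ballCoord_ballSection
  contMDiff_toFun :=
    quotient_contMDiff_of_comp proj continuous_quotient_mk' exists_qchart contMDiff_ballCoord
  contMDiff_invFun := contMDiff_proj.comp contMDiff_ballSection

theorem ballDiffeomorph_proj (A : SpOneOne) : ballDiffeomorph (proj A) = ballCoord A :=
  rfl

theorem surjective_mfderiv_proj (A : SpOneOne) :
    Function.Surjective (mfderiv (𝓡 10) (𝓡 7) proj A) := by
  set k : SpOneOne := (ballSection (ballCoord A))⁻¹ * A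
  have hσ : ContMDiff (𝓡 7) (𝓡 10) ∞ fun x => ballSection (ballDiffeomorph x) * k :=
    (contMDiff_mul_right k).comp (contMDiff_ballSection.comp ballDiffeomorph.contMDiff)
  refine mfderiv_surjective_of_eventually_rightInverse
    (contMDiff_proj.mdifferentiable (by simp) A) (hσ.mdifferentiable (by simp) _)
    (mul_inv_cancel_left _ A) (Filter.Eventually.of_forall fun x => ?_)
  exact (QuotientGroup.mk_mul_of_mem _ (ballSection_ballCoord_inv_mul_mem A)).trans
    (ballDiffeomorph.symm_apply_apply x)

theorem coe_inv (A : SpOneOne) : (A⁻¹ : SpOneOne).1 =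
    !![star (A.1 0 0), -star (A.1 1 0); -star (A.1 0 1), star (A.1 1 1)] := by
  change signatureMatrix * A.1ᴴ * signatureMatrix = _
  ext1 i j
  fin_cases i <;> fin_cases j <;>
    simp [signatureMatrix, Matrix.mul_apply, Matrix.vecMul, dotProduct, Fin.sum_univ_two]

theorem regularMobius_inv (A : SpOneOne) :
    regularMobius (A⁻¹ : SpOneOne).1 = mobiusParam (ballCoord A).1 (ballCoord A).2 := by
  have hentry : ∀ i j, star (A.1 i j) =
      star (A.1 1 1) * star (ballMatrix (ballCoord A).1 (ballCoord A).2 i j) := fun i j => by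
    rw [← star_mul, ← apply_eq_ballMatrix_apply_mul]
  rw [coe_inv, hentry 0 0, hentry 0 1, hentry 1 0,
    ← regularMobius_eq_mobiusParam (norm_coe_unitBall_lt_one _)
      (star_ne_zero.2 (lower_right_ne_zero A))]
  simp [ballMatrix]

end SpOneOne

end BallCoordinates

section RegularMobius

namespace RegularMobius

/-- The bijection `A Sp(1) I₂ ↦ 𝓕_{A⁻¹}` from `Sp(1,1) / Sp(1) I₂` onto `𝓜(𝔹)`. It is defined
through the coordinates in `𝔹 × Sp(1)`, so that it is well defined by construction. -/
def quotientEquiv : (SpOneOne ⧸ spOneScalar) ≃ RegularMobius :=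
  Equiv.ofBijective
    (fun x => ⟨mobiusParam (SpOneOne.ballDiffeomorph x).1 (SpOneOne.ballDiffeomorph x).2, by
      obtain ⟨A, rfl⟩ := QuotientGroup.mk_surjective x
      exact ⟨A⁻¹, (SpOneOne.regularMobius_inv A).symm⟩⟩)
    ⟨fun x y h => by
      obtain ⟨hp, hu⟩ := mobiusParam_injective (norm_coe_unitBall_lt_one _)
        (norm_coe_unitBall_lt_one _) (norm_eq_of_mem_sphere _) (norm_eq_of_mem_sphere _)
        (congrArg Subtype.val h)
      exact SpOneOne.ballDiffeomorph.injective (Prod.ext (Subtype.ext hp) (Subtype.ext hu)),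
    fun ⟨f, A, hf⟩ => ⟨SpOneOne.proj A⁻¹, Subtype.ext <|
      (SpOneOne.regularMobius_inv A⁻¹).symm.trans (by rw [inv_inv]; exact hf.symm)⟩⟩

theorem quotientEquiv_proj (A : SpOneOne) :
    (quotientEquiv (SpOneOne.proj A)).1 = regularMobius (A⁻¹ : SpOneOne).1 :=
  (SpOneOne.regularMobius_inv A).symm

theorem exists_isInducedStructure : ∃ (_ : TopologicalSpace RegularMobius)
    (_ : ChartedSpace (EuclideanSpace ℝ (Fin 7)) RegularMobius), IsInducedStructure :=
  let _ : TopologicalSpace RegularMobius := .induced quotientEquiv.symm inferInstance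
  let f : (SpOneOne ⧸ spOneScalar) ≃ₜ RegularMobius :=
    (quotientEquiv.symm.toHomeomorphOfIsInducing ⟨rfl⟩).symm
  ⟨_, transportChartedSpace f, isManifold_transport f, transportDiffeomorph (𝓡 7) ∞ f,
    quotientEquiv_proj⟩

end RegularMobius

/-- `Sp(1,1) / Sp(1) I₂` is diffeomorphic to `ℝ⁴ × S³`. -/
def euclideanDiffeomorph : (SpOneOne ⧸ spOneScalar) ≃ₘ⟮𝓡 7, (𝓡 4).prod (𝓡 3)⟯
    (EuclideanSpace ℝ (Fin 4) × Metric.sphere (0 : EuclideanSpace ℝ (Fin 4)) 1) :=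
  have : Fact (Module.finrank ℝ (EuclideanSpace ℝ (Fin 4)) = 3 + 1) := ⟨finrank_euclideanSpace_fin⟩
  SpOneOne.ballDiffeomorph.trans <|
    ((unitBallDiffeomorph ℍ[ℝ]).trans
      Quaternion.linearIsometryEquivTuple.toContinuousLinearEquiv.toDiffeomorph).prodCongr
    (sphereDiffeomorph ∞ Quaternion.linearIsometryEquivTuple)

end RegularMobius

end

theorem mainTheorem1 :
    -- the projection `Sp(1,1) → Sp(1,1) / Sp(1) I₂` is a submersion
    (ContMDiff (𝓡 10) (𝓡 7) ∞ SpOneOne.proj ∧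
      ∀ A : SpOneOne, Function.Surjective (mfderiv (𝓡 10) (𝓡 7) SpOneOne.proj A)) ∧
    -- the induced manifold structure on `𝓜(𝔹)` exists
    (∃ (τ : TopologicalSpace RegularMobius)
      (_ : ChartedSpace (EuclideanSpace ℝ (Fin 7)) RegularMobius), IsInducedStructure) ∧
    -- and for it `φ` is a diffeomorphism, so that `𝓜(𝔹)` is diffeomorphic to `ℝ⁴ × S³`
    ∀ (τ : TopologicalSpace RegularMobius)
      (_ : ChartedSpace (EuclideanSpace ℝ (Fin 7)) RegularMobius), IsInducedStructure →
      (∃ Φ : (unitBall × Metric.sphere (0 : ℍ[ℝ]) 1) ≃ₘ⟮𝓘(ℝ, ℍ[ℝ]).prod (𝓡 3), 𝓡 7⟯ RegularMobius,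
        ∀ (a : unitBall) (u : Metric.sphere (0 : ℍ[ℝ]) 1), (Φ (a, u)).1 = mobiusParam a u) ∧
      Nonempty (RegularMobius ≃ₘ⟮𝓡 7, (𝓡 4).prod (𝓡 3)⟯
        (EuclideanSpace ℝ (Fin 4) × Metric.sphere (0 : EuclideanSpace ℝ (Fin 4)) 1)) := by
  refine ⟨⟨SpOneOne.contMDiff_proj, SpOneOne.surjective_mfderiv_proj⟩,
    RegularMobius.exists_isInducedStructure, ?_⟩
  rintro _ _ ⟨-, Ψ, hΨ⟩
  refine ⟨⟨SpOneOne.ballDiffeomorph.symm.trans Ψ, fun a u => ?_⟩,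
    ⟨Ψ.symm.trans euclideanDiffeomorph⟩⟩
  obtain ⟨A, hA⟩ := QuotientGroup.mk_surjective (SpOneOne.ballDiffeomorph.symm (a, u))
  have hcoord : SpOneOne.ballCoord A = (a, u) := by
    rw [← SpOneOne.ballDiffeomorph_proj]
    exact (SpOneOne.ballDiffeomorph.symm_apply_eq.1 hA.symm).symm
  calc (Ψ (SpOneOne.ballDiffeomorph.symm (a, u))).1
      = (Ψ (SpOneOne.proj A)).1 := by rw [← hA]; rfl
    _ = regularMobius (A⁻¹ : SpOneOne).1 := hΨ A
    _ = mobiusParam a u := by rw [SpOneOne.regularMobius_inv, hcoord]
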